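/- Let $R>0$ and $\varepsilon_l=R/l$ for integers $l\ge 1$. Let $su(2)$ have basis $X_1,X_2,X_3$ with $[X_1,X_2]=X_3$, $[X_2,X_3]=X_1$, $[X_3,X_1]=X_2$, let $iso(2)$ have basis $X_1,X_2,X_3$ with $[X_3,X_1]=X_2$, $[X_3,X_2]=-X_1$, $[X_1,X_2]=0$, let $t_\varepsilon:su(2)\to su(2)$ be given by $X_1\mapsto\varepsilon X_1$, $X_2\mapsto\varepsilon X_2$, $X_3\mapsto X_3$, and let $\psi:su(2)\to iso(2)$ be the linear isomorphism $X_1\mapsto -X_2$, $X_2\mapsto X_1$, $X_3\mapsto X_3$. Let $Y_l^m(\theta,\varphi)=i^{|m|}\sqrt{\tfrac{(l-|m|)!}{(l+|m|)!}}\,\sin^{|m|}\theta\;P_l^{(|m|)}(\cos\theta)\,e^{-im\varphi}$ for $|m|\le l$, where $P_l^{(k)}$ is the $k$-th derivative of the Legendre polynomial $P_l$. Let $V_l$ be the space of functions on $S_l=[0,\pi/\varepsilon_l)\times[0,2\pi)$ spanned by $\chi_l^m(\theta,\varphi)=Y_l^m(\varepsilon_l\theta,\varphi)$, $|m|\le l$,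 with the inner product $\langle f,g\rangle_l=\int_0^{2\pi}\int_0^{\pi/\varepsilon_l} f\,\overline g\,(2l+1)\sin(\varepsilon_l\theta)\,\varepsilon_l\,d\theta\,d\varphi$. Let $su(2)$ act on $V_l$ by the representation $\rho_l$ (written $\rho_{(l,\varepsilon_l)}$ in full) with $$\rho_l(X_1)=\tfrac{\sin\varphi}{\varepsilon_l}\partial_\theta+\cot(\varepsilon_l\theta)\cos\varphi\,\partial_\varphi,\quad \rho_l(X_2)=-\tfrac{\cos\varphi}{\varepsilon_l}\partial_\theta+\cot(\varepsilon_l\theta)\sin\varphi\,\partial_\varphi,\quad \rho_l(X_3)=-\partial_\varphi .$$ For $j\le l$ let $\phi_{jl}:V_j\to V_l$ be the linear map with $\phi_{jl}(\chi_j^m)=\chi_l^m$ for $|m|\le j$. Let $\Omega_R$ be the space of functions on $[0,\infty)\times[0,2\pi)$ (the plane in polar coordinates) spanned by the Bessel modes $B_m^R(r,\varphi)=i^mJ_m(Rr)e^{im\varphi}$, $m\in\mathbb Z$, with the inner product in which $\langle B_m^R,B_s^R\rangle=4\pi\,\delta_{ms}$. Let $iso(2)$ act on $\Omega_R$ by the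 representation $\eta_R$ with $$\eta_R(X_1)=-\cos\varphi\,\partial_r+\tfrac{\sin\varphi}{r}\partial_\varphi,\quad \eta_R(X_2)=-\sin\varphi\,\partial_r-\tfrac{\cos\varphi}{r}\partial_\varphi,\quad \eta_R(X_3)=-\partial_\varphi .$$ Then for all $m\in\mathbb Z$, $\theta\ge 0$ and $\varphi$ one has $\lim_{l\to\infty}Y_l^m(R\theta/l,\varphi)=i^mJ_m(R\theta)e^{-im\varphi}$; the $B_m^R$ are linearly independent; all the data above (the maps $\phi_{jl}$, the representations $\rho_l$ and $\eta_R$, the inner products) exist; and $\eta_R$ is the strong contraction of the sequence $(\rho_l,V_l)_{l\ge1}$ with respect to the contraction $su(2)\to iso(2)$ given by $t_{\varepsilon_l}$ and $\psi$. The latter means: * $t_{\varepsilon_l}^{-1}[t_{\varepsilon_l}X,t_{\varepsilon_l}Y]\to\psi^{-1}[\psi X,\psi Y]$ for all $X,Y\in su(2)$; the $S_l$ increase to $[0,\infty)\times[0,2\pi)$; the $V_l$ are inner product subspaces of $L^2$; the $\phi_{jl}$ are isometric, $\phi_{ll}=\mathrm{id}$, and $\phi_{kl}\circ\phi_{jk}=\phi_{jl}$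 for $j\le k\le l$. * (i) For all $j$, $f\in V_j$ and every point $x$ of $[0,\infty)\times[0,2\pi)$ the limit $L(f)(x)=\lim_{l\to\infty}\phi_{jl}(f)(x)$ exists, and $L(f)\in\Omega_R$. * (ii) Every $F\in\Omega_R$ is $L(f)$ for some $j$ and some $f\in V_j$. * (iii) $\langle L(f),L(g)\rangle=\langle f,g\rangle_j$ for all $j$ and $f,g\in V_j$. * (iv) For all $j$, $f\in V_j$ and $Y\in su(2)$, the functions $L(\rho_l(t_{\varepsilon_l}(Y))\phi_{jl}(f))$ converge to $\eta_R(\psi(Y))L(f)$ as $l\to\infty$, both pointwise and in the norm of $\Omega_R$. -/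

import Mathlib

open Filter Topology MeasureTheory

namespace StrongContraction

/-! ## The Lie algebras su(2) and iso(2) -/

/-- The real Lie algebra `su(2)`: coordinates with respect to a basis `X₁, X₂, X₃` with
`[X₁, X₂] = X₃`, `[X₂, X₃] = X₁`, `[X₃, X₁] = X₂`. The coordinates are indexed by `0, 1, 2`. -/
def Su2 : Type := Fin 3 → ℝ

/-- The real Lie algebra `iso(2)`: coordinates with respect to a basis `X₁, X₂, X₃` with
`[X₃, X₁] = X₂`, `[X₃, X₂] = -X₁`, `[X₁, X₂] = 0`. The coordinates are indexed by `0, 1, 2`. -/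
def Iso2 : Type := Fin 3 → ℝ

instance : AddCommGroup Su2 := inferInstanceAs (AddCommGroup (Fin 3 → ℝ))
instance : Module ℝ Su2 := inferInstanceAs (Module ℝ (Fin 3 → ℝ))
instance : TopologicalSpace Su2 := inferInstanceAs (TopologicalSpace (Fin 3 → ℝ))
instance : AddCommGroup Iso2 := inferInstanceAs (AddCommGroup (Fin 3 → ℝ))
instance : Module ℝ Iso2 := inferInstanceAs (Module ℝ (Fin 3 → ℝ))

/-- The element `a X₁ + b X₂ + c X₃` of `su(2)`. -/
def Su2.of (a b c : ℝ) : Su2 := (![a, b, c] : Fin 3 → ℝ)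

/-- The element `a X₁ + b X₂ + c X₃` of `iso(2)`. -/
def Iso2.of (a b c : ℝ) : Iso2 := (![a, b, c] : Fin 3 → ℝ)

theorem Su2.ext3 {x y : Su2} (h0 : x 0 = y 0) (h1 : x 1 = y 1) (h2 : x 2 = y 2) : x = y := by
  funext i
  fin_cases i
  exacts [h0, h1, h2]

theorem Iso2.ext3 {x y : Iso2} (h0 : x 0 = y 0) (h1 : x 1 = y 1) (h2 : x 2 = y 2) : x = y := by
  funext i
  fin_cases i
  exacts [h0, h1, h2]

@[simp] theorem Su2.of_zero (a b c : ℝ) : Su2.of a b c 0 = a := rfl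
@[simp] theorem Su2.of_one (a b c : ℝ) : Su2.of a b c 1 = b := rfl
@[simp] theorem Su2.of_two (a b c : ℝ) : Su2.of a b c 2 = c := rfl
@[simp] theorem Iso2.of_zero (a b c : ℝ) : Iso2.of a b c 0 = a := rfl
@[simp] theorem Iso2.of_one (a b c : ℝ) : Iso2.of a b c 1 = b := rfl
@[simp] theorem Iso2.of_two (a b c : ℝ) : Iso2.of a b c 2 = c := rfl
@[simp] theorem Su2.add_coord (x y : Su2) (i : Fin 3) : (x + y) i = x i + y i := rfl
@[simp] theorem Su2.smul_coord (c : ℝ) (x : Su2) (i : Fin 3) : (c • x) i = c * x i := rfl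
@[simp] theorem Su2.zero_coord (i : Fin 3) : (0 : Su2) i = 0 := rfl
@[simp] theorem Iso2.add_coord (x y : Iso2) (i : Fin 3) : (x + y) i = x i + y i := rfl
@[simp] theorem Iso2.smul_coord (c : ℝ) (x : Iso2) (i : Fin 3) : (c • x) i = c * x i := rfl
@[simp] theorem Iso2.zero_coord (i : Fin 3) : (0 : Iso2) i = 0 := rfl

/-- The bracket of `su(2)` in coordinates. -/
instance : Bracket Su2 Su2 where
  bracket x y := Su2.of (x 1 * y 2 - x 2 * y 1) (x 2 * y 0 - x 0 * y 2) (x 0 * y 1 - x 1 * y 0)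

/-- The bracket of `iso(2)` in coordinates. -/
instance : Bracket Iso2 Iso2 where
  bracket x y := Iso2.of (x 1 * y 2 - x 2 * y 1) (x 2 * y 0 - x 0 * y 2) 0

theorem Su2.bracket_def (x y : Su2) : ⁅x, y⁆ =
    Su2.of (x 1 * y 2 - x 2 * y 1) (x 2 * y 0 - x 0 * y 2) (x 0 * y 1 - x 1 * y 0) := rfl

theorem Iso2.bracket_def (x y : Iso2) : ⁅x, y⁆ =
    Iso2.of (x 1 * y 2 - x 2 * y 1) (x 2 * y 0 - x 0 * y 2) 0 := rfl

instance : LieRing Su2 where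
  add_lie x y z := by apply Su2.ext3 <;> simp [Su2.bracket_def] <;> ring
  lie_add x y z := by apply Su2.ext3 <;> simp [Su2.bracket_def] <;> ring
  lie_self x := by apply Su2.ext3 <;> simp [Su2.bracket_def] <;> ring
  leibniz_lie x y z := by apply Su2.ext3 <;> simp [Su2.bracket_def] <;> ring

instance : LieAlgebra ℝ Su2 where
  lie_smul c x y := by apply Su2.ext3 <;> simp [Su2.bracket_def] <;> ring

instance : LieRing Iso2 where
  add_lie x y z := by apply Iso2.ext3 <;> simp [Iso2.bracket_def] <;> ring
  lie_add x y z := by apply Iso2.ext3 <;> simp [Iso2.bracket_def] <;> ring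
  lie_self x := by apply Iso2.ext3 <;> simp [Iso2.bracket_def] <;> ring
  leibniz_lie x y z := by apply Iso2.ext3 <;> simp [Iso2.bracket_def] <;> ring

instance : LieAlgebra ℝ Iso2 where
  lie_smul c x y := by apply Iso2.ext3 <;> simp [Iso2.bracket_def] <;> ring

/-- The linear isomorphism `ψ` of `su(2)` onto `iso(2)`:
`X₁ ↦ -X₂`, `X₂ ↦ X₁`, `X₃ ↦ X₃`. -/
def psi : Su2 ≃ₗ[ℝ] Iso2 where
  toFun x := Iso2.of (x 1) (-x 0) (x 2)
  invFun y := Su2.of (-y 1) (y 0) (y 2)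
  map_add' x y := by apply Iso2.ext3 <;> simp <;> ring
  map_smul' c x := by apply Iso2.ext3 <;> simp
  left_inv x := by apply Su2.ext3 <;> simp
  right_inv x := by apply Iso2.ext3 <;> simp

/-- The invertible linear map `t_ε` of `su(2)`: `X₁ ↦ ε X₁`, `X₂ ↦ ε X₂`, `X₃ ↦ X₃`. -/
noncomputable def contractionMap (ε : ℝ) (hε : ε ≠ 0) : Su2 ≃ₗ[ℝ] Su2 where
  toFun x := Su2.of (ε * x 0) (ε * x 1) (x 2)
  invFun x := Su2.of (ε⁻¹ * x 0) (ε⁻¹ * x 1) (x 2)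
  map_add' x y := by apply Su2.ext3 <;> simp <;> ring
  map_smul' c x := by apply Su2.ext3 <;> simp <;> ring
  left_inv x := by apply Su2.ext3 <;> simp [hε]
  right_inv x := by apply Su2.ext3 <;> simp [hε]

/-! ## Strong contraction of a sequence of representations -/

/-- A representation of the real Lie algebra `𝔤` on the complex vector space `V`. -/
structure Rep (𝔤 V : Type*) [LieRing 𝔤] [LieAlgebra ℝ 𝔤] [AddCommGroup V] [Module ℂ V] where
  toFun : 𝔤 → Module.End ℂ V
  map_add : ∀ x y v, toFun (x + y) v = toFun x v + toFun y v
  map_smul : ∀ (c : ℝ) x v, toFun (c • x) v = (c : ℂ) • toFun x v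
  map_lie : ∀ x y v, toFun ⁅x, y⁆ v = toFun x (toFun y v) - toFun y (toFun x v)

instance {𝔤 V : Type*} [LieRing 𝔤] [LieAlgebra ℝ 𝔤] [AddCommGroup V] [Module ℂ V] :
    CoeFun (Rep 𝔤 V) fun _ => 𝔤 → Module.End ℂ V := ⟨Rep.toFun⟩

/-- `t` realizes a sequential contraction of the Lie algebra `𝔤`, and the linear isomorphism `ψ`
identifies the limit Lie algebra with `𝔤₀`: for all `X, Y` the limit of
`tₙ⁻¹ [tₙ X, tₙ Y]` exists, and is the bracket transported from `𝔤₀`. -/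
def IsLieContraction {ι 𝔤 𝔤₀ : Type*} [Preorder ι]
    [LieRing 𝔤] [LieAlgebra ℝ 𝔤] [TopologicalSpace 𝔤] [LieRing 𝔤₀] [LieAlgebra ℝ 𝔤₀]
    (t : ι → 𝔤 ≃ₗ[ℝ] 𝔤) (ψ : 𝔤 ≃ₗ[ℝ] 𝔤₀) : Prop :=
  ∀ X Y : 𝔤, Tendsto (fun n => (t n).symm ⁅t n X, t n Y⁆) atTop (𝓝 (ψ.symm ⁅ψ X, ψ Y⁆))

/-- `ip` is a (positive definite) inner product on the complex vector space `V`, linear in the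
first and conjugate-linear in the second variable. -/
structure IsInnerProduct {V : Type*} [AddCommGroup V] [Module ℂ V] (ip : V → V → ℂ) : Prop where
  add_left : ∀ f g h, ip (f + g) h = ip f h + ip g h
  smul_left : ∀ (c : ℂ) f g, ip (c • f) g = c * ip f g
  conj_symm : ∀ f g, ip g f = (starRingEnd ℂ) (ip f g)
  nonneg : ∀ f, 0 ≤ (ip f f).re
  definite : ∀ f, ip f f = 0 → f = 0

/-- The `L²` product `∫_X f ḡ dμ` on a space of functions. -/
noncomputable def l2Inner {Ω : Type*} [MeasurableSpace Ω] (X : Set Ω) (μ : Measure Ω)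
    {V : Submodule ℂ (Ω → ℂ)} (f g : V) : ℂ :=
  ∫ x in X, (f : Ω → ℂ) x * (starRingEnd ℂ) ((g : Ω → ℂ) x) ∂μ

/-- Strong contraction of a sequence of representations `(ρₙ, Vₙ)` of `𝔤` to a representation
`(η, W)` of `𝔤₀`, with respect to the contraction of `𝔤` to `𝔤₀` given by `t` and `ψ`.

Functions on `X n` (and on their union `XX`) are functions on the ambient set `Ω` that vanish
outside `X n` (outside `XX`). `V n` is an inner product subspace of `L²(X n, μ n)`, and
`φ` is the directed system of isometric embeddings. The limit space `W` is a space of functions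
on `XX` with the inner product `ipW`. -/
structure IsStrongContraction {ι 𝔤 𝔤₀ Ω : Type*} [Preorder ι]
    [LieRing 𝔤] [LieAlgebra ℝ 𝔤] [TopologicalSpace 𝔤] [LieRing 𝔤₀] [LieAlgebra ℝ 𝔤₀]
    [MeasurableSpace Ω]
    (t : ι → 𝔤 ≃ₗ[ℝ] 𝔤) (ψ : 𝔤 ≃ₗ[ℝ] 𝔤₀)
    (X : ι → Set Ω) (μ : ι → Measure Ω) (V : ι → Submodule ℂ (Ω → ℂ))
    (φ : ∀ m n : ι, m ≤ n → (V m →ₗ[ℂ] V n))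
    (ρ : ∀ n : ι, Rep 𝔤 (V n))
    (XX : Set Ω) (W : Submodule ℂ (Ω → ℂ)) (ipW : W → W → ℂ)
    (η : Rep 𝔤₀ W) : Prop where
  /-- The Lie algebra contraction. -/
  lie_contraction : IsLieContraction t ψ
  /-- The sets `X n` increase to `XX`. -/
  mono : ∀ m n, m ≤ n → X m ⊆ X n
  union : XX = ⋃ n, X n
  /-- `V n` is an inner product subspace of `L²(X n, μ n)`. -/
  support_V : ∀ n, ∀ f ∈ V n, ∀ x ∉ X n, f x = 0
  memLp_V : ∀ n, ∀ f ∈ V n, MemLp f 2 ((μ n).restrict (X n))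
  inner_V : ∀ n, IsInnerProduct (l2Inner (X n) (μ n) : V n → V n → ℂ)
  /-- `W` is an inner product space of functions on `XX`. -/
  support_W : ∀ F ∈ W, ∀ x ∉ XX, F x = 0
  inner_W : IsInnerProduct ipW
  /-- The embeddings are isometric and compatible. -/
  isometric : ∀ m n (h : m ≤ n) (f g : V m),
    l2Inner (X n) (μ n) (φ m n h f) (φ m n h g) = l2Inner (X m) (μ m) f g
  refl : ∀ n (f : V n), φ n n le_rfl f = f
  compatible : ∀ k m n (h₁ : k ≤ m) (h₂ : m ≤ n) (f : V k),
    φ m n h₂ (φ k m h₁ f) = φ k n (h₁.trans h₂) f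
  /-- The pointwise limits `L f` exist and satisfy the four conditions of a strong contraction. -/
  limit : ∃ L : ∀ m, V m → W,
    (∀ m (f : V m), ∀ x ∈ XX,
      Tendsto (fun n : Set.Ici m => (φ m n n.2 f : Ω → ℂ) x) atTop (𝓝 ((L m f : Ω → ℂ) x))) ∧
    (∀ F : W, ∃ m, ∃ f : V m, L m f = F) ∧
    (∀ m (f g : V m), ipW (L m f) (L m g) = l2Inner (X m) (μ m) f g) ∧
    (∀ m (f : V m) (Y : 𝔤),
      (∀ x ∈ XX,
        Tendsto (fun n : Set.Ici m =>
            (L (n : ι) (ρ (n : ι) (t (n : ι) Y) (φ m n n.2 f)) : Ω → ℂ) x)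
          atTop (𝓝 ((η (ψ Y) (L m f) : Ω → ℂ) x))) ∧
      Tendsto (fun n : Set.Ici m =>
          Real.sqrt (ipW
            (L (n : ι) (ρ (n : ι) (t (n : ι) Y) (φ m n n.2 f)) - η (ψ Y) (L m f))
            (L (n : ι) (ρ (n : ι) (t (n : ι) Y) (φ m n n.2 f)) - η (ψ Y) (L m f))).re)
        atTop (𝓝 0))

/-! ## Spherical harmonics on dilated spheres

Points of the (dilated) sphere are written in coordinates `p = (θ, φ)`. -/

/-- The dilated sphere in polar coordinates, `[0, π/ε) × [0, 2π)`. -/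
def disc (ε : ℝ) : Set (ℝ × ℝ) := Set.Ico 0 (Real.pi / ε) ×ˢ Set.Ico 0 (2 * Real.pi)

/-- The plane in polar coordinates, `[0, ∞) × [0, 2π)`. -/
def plane : Set (ℝ × ℝ) := Set.Ici 0 ×ˢ Set.Ico 0 (2 * Real.pi)

open Polynomial in
/-- The spherical harmonic `Y_l^m`, in the normalization
`Y_l^m(θ, φ) = i^|m| √((l-|m|)!/(l+|m|)!) sin^|m| θ P_l^(|m|)(cos θ) e^{-imφ}`,
where `P_l^(k)` is the `k`-th derivative of the Legendre polynomial
`P_l = (1 / (2^l l!)) (d/dz)^l (z² - 1)^l`. It is meant for `|m| ≤ l`. -/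
noncomputable def sphericalY (l : ℕ) (m : ℤ) (θ φ : ℝ) : ℂ :=
  Complex.I ^ m.natAbs *
    ((Real.sqrt ((l - m.natAbs).factorial / (l + m.natAbs).factorial) *
      Real.sin θ ^ m.natAbs *
      ((derivative^[l + m.natAbs] ((X ^ 2 - 1 : ℝ[X]) ^ l)).eval (Real.cos θ) /
        (2 ^ l * l.factorial)) : ℝ) : ℂ) *
    Complex.exp (-(Complex.I * m * φ))

/-- `Y_l^m` as a function on the sphere `disc 1` (extended by zero). -/
noncomputable def sphereFun (l : ℕ) (m : ℤ) : ℝ × ℝ → ℂ :=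
  (disc 1).indicator fun p => sphericalY l m p.1 p.2

/-- The space of spherical harmonics of degree `l`. -/
noncomputable def sphHarm (l : ℕ) : Submodule ℂ (ℝ × ℝ → ℂ) :=
  Submodule.span ℂ (sphereFun l '' Set.Icc (-(l : ℤ)) l)

/-- The map `f ↦ f ∘ ψ_ε`, where `ψ_ε(θ, φ) = (εθ, φ)`. -/
def dilate (ε : ℝ) : (ℝ × ℝ → ℂ) →ₗ[ℂ] (ℝ × ℝ → ℂ) where
  toFun f := fun p => f (ε * p.1, p.2)
  map_add' _ _ := rfl
  map_smul' _ _ := rfl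

/-- The space of spherical harmonics of degree `l` on the dilated sphere `disc ε`. -/
noncomputable def dilatedHarm (l : ℕ) (ε : ℝ) : Submodule ℂ (ℝ × ℝ → ℂ) :=
  (sphHarm l).map (dilate ε)

/-- The function `χ_{l,ε}^m(θ, φ) = Y_l^m(εθ, φ)` on the dilated sphere. -/
noncomputable def chi (l : ℕ) (ε : ℝ) (m : ℤ) : ℝ × ℝ → ℂ := dilate ε (sphereFun l m)

/-- The measure `(2l+1) sin(εθ) ε dθ dφ`; it is used only on `disc ε`. -/
noncomputable def dilatedMeasure (l : ℕ) (ε : ℝ) : Measure (ℝ × ℝ) :=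
  volume.withDensity fun p => ENNReal.ofReal ((2 * l + 1) * Real.sin (ε * p.1) * ε)

/-- The partial derivative in the radial variable along the set `s` of its values. -/
noncomputable def dRadial (s : Set ℝ) (f : ℝ × ℝ → ℂ) (p : ℝ × ℝ) : ℂ :=
  derivWithin (fun x => f (x, p.2)) s p.1

/-- The partial derivative in the angle `φ ∈ [0, 2π)`. -/
noncomputable def dAngle (f : ℝ × ℝ → ℂ) (p : ℝ × ℝ) : ℂ :=
  derivWithin (fun x => f (p.1, x)) (Set.Ico 0 (2 * Real.pi)) p.2

/-- The differential operators of `su(2)` on the dilated sphere: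
`X₁ ↦ sin φ (1/ε) ∂_θ + cot(εθ) cos φ ∂_φ`,
`X₂ ↦ -cos φ (1/ε) ∂_θ + cot(εθ) sin φ ∂_φ`, `X₃ ↦ -∂_φ`. -/
noncomputable def suOperator (ε : ℝ) (Y : Su2) (f : ℝ × ℝ → ℂ) (p : ℝ × ℝ) : ℂ :=
  Y 0 * (Real.sin p.2 * (1 / ε) * dRadial (Set.Ico 0 (Real.pi / ε)) f p +
      Real.cot (ε * p.1) * Real.cos p.2 * dAngle f p) +
    Y 1 * (-Real.cos p.2 * (1 / ε) * dRadial (Set.Ico 0 (Real.pi / ε)) f p +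
      Real.cot (ε * p.1) * Real.sin p.2 * dAngle f p) +
    Y 2 * (-dAngle f p)

/-- `ρ` is the representation of `su(2)` on the spherical harmonics of degree `l` on the dilated
sphere by the above differential operators. The point `θ = 0`, where the coordinates are singular,
is left out of the formula; since the functions of the space are continuous, the formula for
`θ > 0` determines `ρ`. -/
def IsDilatedRep (l : ℕ) (ε : ℝ) (ρ : Rep Su2 (dilatedHarm l ε)) : Prop :=
  ∀ (Y : Su2) (f : dilatedHarm l ε), ∀ p ∈ disc ε, 0 < p.1 →
    (ρ Y f : ℝ × ℝ → ℂ) p = suOperator ε Y f p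

/-! ## Bessel modes on the plane -/

/-- The Bessel function `J_n` of order `n ∈ ℕ`. -/
noncomputable def besselJNat (n : ℕ) (x : ℝ) : ℝ :=
  ∑' k : ℕ, (-1) ^ k / (k.factorial * (k + n).factorial) * (x / 2) ^ (2 * k + n)

/-- The Bessel function `J_m` of integer order, with `J_{-n} = (-1)^n J_n`. -/
noncomputable def besselJ (m : ℤ) (x : ℝ) : ℝ :=
  if 0 ≤ m then besselJNat m.natAbs x else (-1) ^ m.natAbs * besselJNat m.natAbs x

/-- The Bessel mode `B_m^R(r, φ) = i^m J_m(Rr) e^{imφ}` on the plane (extended by zero outside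
the range of the polar coordinates). -/
noncomputable def besselMode (R : ℝ) (m : ℤ) : ℝ × ℝ → ℂ :=
  plane.indicator fun p =>
    Complex.I ^ m * (besselJ m (R * p.1) : ℂ) * Complex.exp (Complex.I * m * p.2)

/-- The span of the Bessel modes. -/
noncomputable def besselSpace (R : ℝ) : Submodule ℂ (ℝ × ℝ → ℂ) :=
  Submodule.span ℂ (Set.range (besselMode R))

/-- The Bessel mode as an element of the span. -/
noncomputable def besselVec (R : ℝ) (m : ℤ) : besselSpace R :=
  ⟨besselMode R m, Submodule.subset_span ⟨m, rfl⟩⟩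

/-- The differential operators of `iso(2)` in polar coordinates on the plane:
`X₁ ↦ -cos φ ∂_r + (sin φ / r) ∂_φ`, `X₂ ↦ -sin φ ∂_r - (cos φ / r) ∂_φ`, `X₃ ↦ -∂_φ`. -/
noncomputable def isoOperator (Y : Iso2) (f : ℝ × ℝ → ℂ) (p : ℝ × ℝ) : ℂ :=
  Y 0 * (-Real.cos p.2 * dRadial (Set.Ici 0) f p + Real.sin p.2 / p.1 * dAngle f p) +
    Y 1 * (-Real.sin p.2 * dRadial (Set.Ici 0) f p - Real.cos p.2 / p.1 * dAngle f p) +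
    Y 2 * (-dAngle f p)

/-- `η` is the representation of `iso(2)` on the span of the Bessel modes by the above
differential operators. As above, the formula for `r > 0` determines `η`. -/
def IsPlaneRep (R : ℝ) (η : Rep Iso2 (besselSpace R)) : Prop :=
  ∀ (Y : Iso2) (F : besselSpace R), ∀ p ∈ plane, 0 < p.1 →
    (η Y F : ℝ × ℝ → ℂ) p = isoOperator Y F p

/-! ## The data of the contraction -/

/-- `ε_l = R / l`, for `l ≥ 1`. -/
noncomputable def eps (R : ℝ) (l : ℕ+) : ℝ := R / (l : ℕ)

theorem eps_ne_zero {R : ℝ} (hR : 0 < R) (l : ℕ+) : eps R l ≠ 0 :=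
  div_ne_zero hR.ne' (Nat.cast_ne_zero.mpr l.ne_zero)

/-- `φ` consists of the linear maps with `φ_{ij}(χ_{i,ε_i}^m) = χ_{j,ε_j}^m` for `|m| ≤ i`. -/
def IsHarmonicEmbedding (R : ℝ)
    (φ : ∀ i j : ℕ+, i ≤ j → (dilatedHarm i (eps R i) →ₗ[ℂ] dilatedHarm j (eps R j))) : Prop :=
  ∀ (i j : ℕ+) (h : i ≤ j), ∀ m ∈ Set.Icc (-((i : ℕ) : ℤ)) ((i : ℕ) : ℤ),
    ∀ f : dilatedHarm i (eps R i), (f : ℝ × ℝ → ℂ) = chi i (eps R i) m →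
      (φ i j h f : ℝ × ℝ → ℂ) = chi j (eps R j) m

/-- `ip` is the inner product on the span of the Bessel modes in which they are orthogonal and
have squared norm `4π` (the area of the unit sphere). -/
def IsBesselInner (R : ℝ) (ip : besselSpace R → besselSpace R → ℂ) : Prop :=
  IsInnerProduct ip ∧
    ∀ m s : ℤ, ip (besselVec R m) (besselVec R s) = if m = s then ((4 * Real.pi : ℝ) : ℂ) else 0

end StrongContraction

/-!
The spherical harmonics `Y_l^m` and the Bessel modes are governed by ladder operators of the same
shape. Write `Y_l^m = i^m g_m(θ) e^{-imφ}` for all `m ∈ ℤ` (`legendreInt`, `sphericalY_eq`). The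
differential equation of the derivatives of `(z² - 1)^l` gives `g_m' = m cot θ g_m - a_m g_{m+1}`
and `2m cot θ g_m = a_m g_{m+1} + a_{m-1} g_{m-1}` with `a_m = √((l - m)(l + m + 1))`. So `X₁ ± iX₂`
shift `m` by one with coefficient `a` (`suOperator_chi`), and an integration by parts gives
`∫ g_m² sin = 2 / (2l + 1)` for every `|m| ≤ l`, hence `⟨χ_l^m, χ_l^s⟩ = 4π δ_{ms}`
(`l2Inner_chiVec`). The power series of `J_m` gives the analogous relations with constant
coefficient `R` (`isoOperator_besselMode`). Both representations are therefore instances of one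
algebraic construction (`LadderSystem.rep`). A function in either space is determined by its values
away from the coordinate singularity, because it is continuous there in the radial variable; so any
representations given by the differential operators have these matrix coefficients
(`IsDilatedRep.apply_chiVec`, `IsPlaneRep.apply_besselVec`).

Expanding `g_m` at the pole and passing to the limit term by term gives the Mehler–Heine limit
`g_m(x / l) → J_m(x)` (`tendsto_legendreNat`). Hence the pointwise limit map is
`χ_l^m ↦ B_{-m}^R` (`limitMap`), which carries one orthogonal basis into another with the same
norms. For the convergence of the operators only `ε_l a_m → R` is needed, since on each `χ^m` the
difference is a combination of two fixed modes with coefficients that tend to zero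
(`isNull_contraction`).
-/

open Filter Topology MeasureTheory

namespace StrongContraction

/-! ### Ladder relations and norms of the associated Legendre functions -/

open Polynomial in
/-- The `N`-th derivative of `(z² - 1)^l`, as a function. -/
noncomputable def rodrigues (l N : ℕ) (z : ℝ) : ℝ :=
  (derivative^[N] ((X ^ 2 - 1 : ℝ[X]) ^ l)).eval z

open Polynomial in
theorem hasDerivAt_rodrigues (l N : ℕ) (z : ℝ) :
    HasDerivAt (rodrigues l N) (rodrigues l (N + 1) z) z := by
  unfold rodrigues
  rw [Function.iterate_succ_apply']
  exact Polynomial.hasDerivAt _ z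

open Polynomial in
theorem rodrigues_eq_zero {l N : ℕ} (h : 2 * l < N) (z : ℝ) : rodrigues l N z = 0 := by
  unfold rodrigues
  rw [Polynomial.iterate_derivative_eq_zero, eval_zero]
  refine lt_of_le_of_lt ?_ h
  calc ((X ^ 2 - 1 : ℝ[X]) ^ l).natDegree ≤ l * (X ^ 2 - 1 : ℝ[X]).natDegree := natDegree_pow_le
    _ ≤ l * 2 := by gcongr; compute_degree
    _ = 2 * l := mul_comm _ _

open Polynomial in
theorem rodrigues_one (l : ℕ) (z : ℝ) :
    (z ^ 2 - 1) * rodrigues l 1 z = 2 * l * z * rodrigues l 0 z := by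
  simp only [rodrigues, Function.iterate_one, Function.iterate_zero_apply]
  rcases l with _ | l
  · simp
  · simp only [derivative_pow_succ]
    simp
    ring

/-- The differential equation of the derivatives of `(z² - 1)^l`. For `N + 1 = l + n` it is the
`(n - 1)`-st derivative of Legendre's equation. -/
theorem rodrigues_ode (l N : ℕ) (z : ℝ) :
    (z ^ 2 - 1) * rodrigues l (N + 2) z + 2 * (N + 1 - l) * z * rodrigues l (N + 1) z
      = (N + 1) * (2 * l - N) * rodrigues l N z := by
  have hsq : ∀ z : ℝ, HasDerivAt (fun z : ℝ => z ^ 2 - 1) (2 * z) z := fun z => by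
    simpa using (hasDerivAt_pow 2 z).sub_const 1
  have hlin : ∀ c z : ℝ, HasDerivAt (fun z : ℝ => c * z) c z := fun c z => by
    simpa using (hasDerivAt_id z).const_mul c
  induction N generalizing z with
  | zero =>
    have h1 := (hsq z).mul (hasDerivAt_rodrigues l 1 z)
    have h2 := (hlin (2 * l) z).mul (hasDerivAt_rodrigues l 0 z)
    have h3 := h1.unique (h2.congr_of_eventuallyEq (.of_forall fun z => rodrigues_one l z))
    push_cast
    simp only [zero_add, Nat.reduceAdd] at h3 ⊢
    linear_combination h3
  | succ N ih =>
    have h1 := ((hsq z).mul (hasDerivAt_rodrigues l (N + 2) z)).add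
      ((hlin (2 * (N + 1 - l)) z).mul (hasDerivAt_rodrigues l (N + 1) z))
    have h2 := (hasDerivAt_rodrigues l N z).const_mul ((N + 1 : ℝ) * (2 * l - N))
    have h3 := h1.unique (h2.congr_of_eventuallyEq (.of_forall fun z => ih z))
    push_cast
    simp only [add_assoc, Nat.reduceAdd] at h3 ⊢
    linear_combination h3

open Polynomial in
/-- The expansion of the derivatives of `(z² - 1)^l = (z - 1)^l ((z - 1) + 2)^l` at `z = 1`. -/
theorem rodrigues_eq_sum (l N : ℕ) (z : ℝ) :
    rodrigues l N z = ∑ j ∈ Finset.range (l + 1),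
      (l.choose j * 2 ^ (l - j) * (l + j).descFactorial N) * (z - 1) ^ (l + j - N) := by
  have h : (X ^ 2 - 1 : ℝ[X]) ^ l = ∑ j ∈ Finset.range (l + 1),
      C (l.choose j * 2 ^ (l - j) : ℝ) * (X - C 1) ^ (l + j) := by
    have h1 : (X ^ 2 - 1 : ℝ[X]) = (X - C 1) * ((X - C 1) + C 2) := by
      simp only [map_one, show (C 2 : ℝ[X]) = 2 from rfl]
      ring
    rw [h1, mul_pow, add_pow, Finset.mul_sum]
    refine Finset.sum_congr rfl fun j _ => ?_
    simp only [map_mul, map_pow, map_natCast]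
    ring
  rw [rodrigues, h, iterate_derivative_sum, eval_finsetSum]
  refine Finset.sum_congr rfl fun j _ => ?_
  rw [iterate_derivative_C_mul, iterate_derivative_X_sub_pow]
  simp [mul_assoc]

/-- The `θ`-dependent factor of `Y_l^n` for `n ≥ 0`. -/
noncomputable def legendreNat (l n : ℕ) (θ : ℝ) : ℝ :=
  Real.sqrt ((l - n).factorial / (l + n).factorial) * Real.sin θ ^ n *
    (rodrigues l (l + n) (Real.cos θ) / (2 ^ l * l.factorial))

/-- The `θ`-dependent factor of `Y_l^m`, with the sign that makes the ladder relations uniform in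
`m`: it is multiplied by `(-1)^m` under `m ↦ -m`. -/
noncomputable def legendreInt (l : ℕ) (m : ℤ) (θ : ℝ) : ℝ :=
  if 0 ≤ m then legendreNat l m.natAbs θ else (-1) ^ m.natAbs * legendreNat l m.natAbs θ

/-- The matrix coefficient `√((l - m)(l + m + 1))` of the ladder operators. It vanishes at the
ends `m = l` and `m = -l - 1`. -/
noncomputable def ladder (l : ℕ) (m : ℤ) : ℝ := Real.sqrt ((l - m) * (l + m + 1))

theorem ladder_sq {l : ℕ} {m : ℤ} (h1 : -(l : ℤ) - 1 ≤ m) (h2 : m ≤ l) :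
    ladder l m * ladder l m = (l - m) * (l + m + 1) := by
  refine Real.mul_self_sqrt (mul_nonneg ?_ ?_)
  · exact sub_nonneg.2 (by exact_mod_cast h2)
  · have : (0 : ℤ) ≤ l + m + 1 := by omega
    exact_mod_cast this

theorem ladder_self (l : ℕ) : ladder l l = 0 := by simp [ladder]

theorem ladder_bot (l : ℕ) : ladder l (-(l : ℤ) - 1) = 0 := by
  rw [ladder, Real.sqrt_eq_zero']
  push_cast
  apply le_of_eq
  ring

theorem ladder_neg (l : ℕ) (m : ℤ) : ladder l (-m) = ladder l (m - 1) := by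
  unfold ladder
  push_cast
  ring_nf

theorem legendreNat_eq_zero {l n : ℕ} (h : l < n) (θ : ℝ) : legendreNat l n θ = 0 := by
  rw [legendreNat, rodrigues_eq_zero (by omega)]
  simp

theorem sqrt_factorial_ladder {l n : ℕ} (h : n < l) :
    Real.sqrt ((l - n).factorial / (l + n).factorial) =
      ladder l n * Real.sqrt ((l - (n + 1)).factorial / (l + (n + 1)).factorial) := by
  have h1 : l - n = (l - (n + 1)) + 1 := by omega
  have h2 : (0 : ℝ) ≤ (l - n) := sub_nonneg.2 (by exact_mod_cast h.le)
  rw [ladder, ← Real.sqrt_mul (by push_cast; positivity), h1, ← add_assoc, Nat.factorial_succ,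
    Nat.factorial_succ (l + n)]
  congr 1
  have h3 : ((l - (n + 1) : ℕ) : ℝ) = l - (n + 1) := by
    rw [Nat.cast_sub h]; push_cast; ring
  push_cast
  rw [h3]
  field_simp
  ring

theorem hasDerivAt_legendreNat (l n : ℕ) {θ : ℝ} (hs : Real.sin θ ≠ 0) :
    HasDerivAt (legendreNat l n)
      (n * Real.cot θ * legendreNat l n θ - ladder l n * legendreNat l (n + 1) θ) θ := by
  have h1 := ((Real.hasDerivAt_sin θ).pow n).mul
    (((hasDerivAt_rodrigues l (l + n) (Real.cos θ)).comp θ (Real.hasDerivAt_cos θ)).div_const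
      (2 ^ l * l.factorial))
  have h2 := h1.const_mul (Real.sqrt ((l - n).factorial / (l + n).factorial))
  have h3 : ladder l n * legendreNat l (n + 1) θ =
      Real.sqrt ((l - n).factorial / (l + n).factorial) * Real.sin θ ^ (n + 1) *
        (rodrigues l (l + n + 1) (Real.cos θ) / (2 ^ l * l.factorial)) := by
    rcases lt_or_ge n l with h | h
    · rw [sqrt_factorial_ladder h, legendreNat]
      ring_nf
    · rw [legendreNat_eq_zero (by omega), rodrigues_eq_zero (by omega)]
      simp
  rw [h3]
  refine (h2.congr_of_eventuallyEq (.of_forall fun x => ?_)).congr_deriv ?_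
  · simp only [legendreNat, Pi.mul_apply, Pi.pow_apply, Function.comp, mul_assoc]
  · rw [Real.cot_eq_cos_div_sin, legendreNat]
    simp only [Pi.pow_apply, Function.comp]
    rcases n with _ | n
    · simp
      ring
    · simp only [Nat.add_sub_cancel, pow_succ]
      field_simp
      ring

/-- Legendre's equation, as a relation between the factors for three consecutive `n`. -/
theorem legendreNat_three_term (l n : ℕ) {θ : ℝ} (hs : Real.sin θ ≠ 0) :
    2 * (n + 1 : ℕ) * Real.cot θ * legendreNat l (n + 1) θ =
      ladder l (n + 1 : ℕ) * legendreNat l (n + 2) θ + ladder l n * legendreNat l n θ := by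
  rcases lt_or_ge n l with h | h
  swap
  · rw [legendreNat_eq_zero (by omega), legendreNat_eq_zero (by omega)]
    rcases h.eq_or_lt with rfl | h
    · rw [ladder_self]; simp
    · rw [legendreNat_eq_zero h]; simp
  have hode := rodrigues_ode l (l + n) (Real.cos θ)
  have hl : ladder l n * legendreNat l n θ = (l - n) * (l + n + 1) *
      (Real.sqrt ((l - (n + 1)).factorial / (l + (n + 1)).factorial) * Real.sin θ ^ n *
        (rodrigues l (l + n) (Real.cos θ) / (2 ^ l * l.factorial))) := by
    have := ladder_sq (l := l) (m := n) (by omega) (by omega)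
    push_cast at this
    rw [legendreNat, sqrt_factorial_ladder h, ← this]
    ring
  have hu : ladder l (n + 1 : ℕ) * legendreNat l (n + 2) θ =
      Real.sqrt ((l - (n + 1)).factorial / (l + (n + 1)).factorial) * Real.sin θ ^ (n + 2) *
        (rodrigues l (l + n + 2) (Real.cos θ) / (2 ^ l * l.factorial)) := by
    rcases (show n + 1 ≤ l from h).eq_or_lt with h | h
    · rw [legendreNat_eq_zero (by omega), rodrigues_eq_zero (by omega)]
      simp
    · rw [sqrt_factorial_ladder h, legendreNat]
      ring_nf
  rw [hl, hu, legendreNat, Real.cot_eq_cos_div_sin, ← add_assoc]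
  have hcs : Real.cos θ ^ 2 - 1 = - Real.sin θ ^ 2 := by
    rw [Real.sin_sq]; ring
  rw [hcs] at hode
  generalize Real.sqrt _ = s
  push_cast at hode ⊢
  simp only [pow_succ, pow_zero, one_mul] at hode ⊢
  field_simp
  linear_combination s * hode

@[simp] theorem legendreInt_natCast (l n : ℕ) : legendreInt l n = legendreNat l n := by
  funext θ
  simp [legendreInt]

@[simp] theorem legendreInt_neg_natCast (l n : ℕ) (θ : ℝ) :
    legendreInt l (-(n : ℤ)) θ = (-1) ^ n * legendreNat l n θ := by
  rcases n with _ | n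
  · simp [legendreInt]
  · rw [legendreInt, if_neg (by omega), Int.natAbs_neg, Int.natAbs_natCast]

theorem legendreInt_three_term (l : ℕ) (m : ℤ) {θ : ℝ} (hs : Real.sin θ ≠ 0) :
    2 * m * Real.cot θ * legendreInt l m θ =
      ladder l m * legendreInt l (m + 1) θ + ladder l (m - 1) * legendreInt l (m - 1) θ := by
  have h0 : ladder l (-1) = ladder l 0 := by simpa using (ladder_neg l 0).symm
  obtain ⟨n, rfl | rfl⟩ := m.eq_nat_or_neg
  · rcases n with _ | n
    · have h1 := legendreInt_neg_natCast l 1 θ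
      have h2 := legendreInt_natCast l 1
      push_cast at h1 h2
      simp [h0, h1, h2]
    · have h := legendreNat_three_term l n hs
      have e1 : ((n + 1 : ℕ) : ℤ) + 1 = (n + 2 : ℕ) := by push_cast; ring
      have e2 : ((n + 1 : ℕ) : ℤ) - 1 = (n : ℕ) := by push_cast; ring
      rw [e1, e2]
      simpa only [legendreInt_natCast, Int.cast_natCast] using h
  · rcases n with _ | n
    · have h1 := legendreInt_neg_natCast l 1 θ
      have h2 := legendreInt_natCast l 1
      push_cast at h1 h2
      simp [h0, h1, h2]
    · have h := legendreNat_three_term l n hs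
      have e1 : -((n + 1 : ℕ) : ℤ) + 1 = -(n : ℕ) := by push_cast; ring
      have e2 : -((n + 1 : ℕ) : ℤ) - 1 = -(n + 2 : ℕ) := by push_cast; ring
      have e3 : ladder l (-((n + 1 : ℕ) : ℤ)) = ladder l n := by
        rw [ladder_neg]; push_cast; ring_nf
      have e4 : ladder l (-((n + 2 : ℕ) : ℤ)) = ladder l (n + 1 : ℕ) := by
        rw [ladder_neg]; push_cast; ring_nf
      rw [e1, e2, e3, e4]
      simp only [legendreInt_neg_natCast]
      push_cast at h ⊢
      simp only [pow_succ]
      linear_combination (-1) ^ n * h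

theorem hasDerivAt_legendreInt (l : ℕ) (m : ℤ) {θ : ℝ} (hs : Real.sin θ ≠ 0) :
    HasDerivAt (legendreInt l m)
      (m * Real.cot θ * legendreInt l m θ - ladder l m * legendreInt l (m + 1) θ) θ := by
  obtain ⟨n, rfl | rfl⟩ := m.eq_nat_or_neg
  · have e1 : (n : ℤ) + 1 = (n + 1 : ℕ) := by push_cast; ring
    rw [e1]
    simpa only [legendreInt_natCast, Int.cast_natCast] using hasDerivAt_legendreNat l n hs
  · have h := (hasDerivAt_legendreNat l n hs).const_mul ((-1 : ℝ) ^ n)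
    have h3 := legendreInt_three_term l (-(n : ℤ)) hs
    have e1 : -(n : ℤ) - 1 = -(n + 1 : ℕ) := by push_cast; ring
    have e2 : ladder l (-((n + 1 : ℕ) : ℤ)) = ladder l n := by
      rw [ladder_neg]; push_cast; ring_nf
    refine (h.congr_of_eventuallyEq (.of_forall fun x => ?_)).congr_deriv ?_
    · exact legendreInt_neg_natCast l n x
    · rw [e1, e2] at h3
      simp only [legendreInt_neg_natCast] at h3 ⊢
      push_cast at h3 ⊢
      simp only [pow_succ] at h3
      linear_combination -h3

theorem continuous_rodrigues (l N : ℕ) : Continuous (rodrigues l N) :=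
  Polynomial.continuous _

theorem continuous_legendreNat (l n : ℕ) : Continuous (legendreNat l n) := by
  unfold legendreNat
  have := (continuous_rodrigues l (l + n)).comp Real.continuous_cos
  simp only [Function.comp_def] at this
  fun_prop

theorem continuous_legendreInt (l : ℕ) (m : ℤ) : Continuous (legendreInt l m) := by
  have := continuous_legendreNat l m.natAbs
  unfold legendreInt
  split_ifs <;> fun_prop

/-- The ladder relations give
`(g_n g_{n+1} sin)' = √((l - n)(l + n + 1)) (g_n² - g_{n+1}²) sin`. -/
theorem integral_legendreNat_succ {l n : ℕ} (h : n < l) :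
    ∫ θ in (0 : ℝ)..Real.pi, legendreNat l n θ ^ 2 * Real.sin θ =
      ∫ θ in (0 : ℝ)..Real.pi, legendreNat l (n + 1) θ ^ 2 * Real.sin θ := by
  have c1 := continuous_legendreNat l n
  have c2 := continuous_legendreNat l (n + 1)
  have hpos : ladder l n ≠ 0 := by
    have h1 := ladder_sq (l := l) (m := n) (by omega) (by omega)
    have h2 : (0 : ℝ) < l - n := sub_pos.2 (by exact_mod_cast h)
    intro h0
    rw [h0] at h1
    push_cast at h1
    have : (0 : ℝ) < (l - n) * (l + n + 1) := by positivity
    linarith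
  have key := intervalIntegral.integral_eq_sub_of_hasDerivAt_of_le Real.pi_pos.le
    (f := fun θ => legendreNat l n θ * legendreNat l (n + 1) θ * Real.sin θ)
    (f' := fun θ => ladder l n *
      (legendreNat l n θ ^ 2 * Real.sin θ - legendreNat l (n + 1) θ ^ 2 * Real.sin θ))
    (by fun_prop) (fun θ hθ => ?_) (Continuous.intervalIntegrable (by fun_prop) _ _)
  · rw [intervalIntegral.integral_const_mul, intervalIntegral.integral_sub
      (Continuous.intervalIntegrable (by fun_prop) _ _)
      (Continuous.intervalIntegrable (by fun_prop) _ _)] at key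
    simpa [hpos, sub_eq_zero] using key
  · have hs : Real.sin θ ≠ 0 := (Real.sin_pos_of_mem_Ioo hθ).ne'
    refine (((hasDerivAt_legendreNat l n hs).mul (hasDerivAt_legendreNat l (n + 1) hs)).mul
      (Real.hasDerivAt_sin θ)).congr_deriv ?_
    have h3 := legendreNat_three_term l n hs
    have hcs : Real.cot θ * Real.sin θ = Real.cos θ := by
      rw [Real.cot_eq_cos_div_sin]; field_simp
    simp only [Pi.mul_apply]
    push_cast at h3 ⊢
    linear_combination legendreNat l n θ * Real.sin θ * h3 -
      legendreNat l n θ * legendreNat l (n + 1) θ * hcs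

/-- For `n = l` the derivative of the Legendre polynomial is constant, and the integral is a
Wallis integral. -/
theorem integral_legendreNat_self (l : ℕ) :
    ∫ θ in (0 : ℝ)..Real.pi, legendreNat l l θ ^ 2 * Real.sin θ = 2 / (2 * l + 1) := by
  have hr : ∀ z, rodrigues l (l + l) z = (2 * l).factorial := by
    intro z
    rw [rodrigues_eq_sum, Finset.sum_range_succ, Finset.sum_eq_zero, ← two_mul]
    · simp [Nat.descFactorial_self]
    · intro j hj
      rw [Nat.descFactorial_of_lt (by have := Finset.mem_range.1 hj; omega)]
      simp
  have hp : ∀ l : ℕ, ∏ i ∈ Finset.range l, (2 * (i : ℝ) + 2) / (2 * i + 3) =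
      (2 ^ l * l.factorial) ^ 2 / ((2 * l).factorial * (2 * l + 1)) := by
    intro l
    induction l with
    | zero => simp
    | succ l ih =>
      rw [Finset.prod_range_succ, ih, show 2 * (l + 1) = 2 * l + 1 + 1 by ring,
        Nat.factorial_succ, Nat.factorial_succ, Nat.factorial_succ]
      push_cast
      field_simp
      ring
  have h : ∀ θ, legendreNat l l θ ^ 2 * Real.sin θ =
      ((2 * l).factorial / (2 ^ l * l.factorial) ^ 2) * Real.sin θ ^ (2 * l + 1) := by
    intro θ
    rw [legendreNat, hr, mul_pow, mul_pow, Real.sq_sqrt (by positivity), Nat.sub_self, ← two_mul,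
      Nat.factorial_zero, Nat.cast_one]
    field_simp
    ring
  simp_rw [h]
  rw [intervalIntegral.integral_const_mul, integral_sin_pow_odd, hp]
  field_simp

theorem integral_legendreNat_sq {l n : ℕ} (h : n ≤ l) :
    ∫ θ in (0 : ℝ)..Real.pi, legendreNat l n θ ^ 2 * Real.sin θ = 2 / (2 * l + 1) := by
  obtain ⟨k, rfl⟩ : ∃ k, l = n + k := ⟨l - n, by omega⟩
  clear h
  rw [← integral_legendreNat_self]
  generalize hl : n + k = l
  induction k generalizing n with
  | zero => simp [← hl]
  | succ k ih =>
    rw [integral_legendreNat_succ (by omega), ih (by omega)]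

theorem integral_legendreInt_sq {l : ℕ} {m : ℤ} (h : m.natAbs ≤ l) :
    ∫ θ in (0 : ℝ)..Real.pi, legendreInt l m θ ^ 2 * Real.sin θ = 2 / (2 * l + 1) := by
  rw [← integral_legendreNat_sq h]
  congr 1
  funext θ
  rw [legendreInt]
  split_ifs
  · rfl
  · rw [mul_pow, ← pow_mul, mul_comm _ 2, pow_mul]
    simp

theorem legendreInt_eq_zero {l : ℕ} {m : ℤ} (h : l < m.natAbs) (θ : ℝ) :
    legendreInt l m θ = 0 := by
  rw [legendreInt, legendreNat_eq_zero h]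
  simp

/-- The signs in `legendreInt` and in `i^m` versus `i^|m|` cancel. -/
theorem sphericalY_eq (l : ℕ) (m : ℤ) (θ φ : ℝ) :
    sphericalY l m θ φ =
      Complex.I ^ m * (legendreInt l m θ : ℂ) * Complex.exp (-(Complex.I * m * φ)) := by
  obtain ⟨n, rfl | rfl⟩ := m.eq_nat_or_neg
  · simp [sphericalY, legendreNat, rodrigues]
  · have hI : Complex.I ^ (-(n : ℤ)) * (-1) ^ n = Complex.I ^ n := by
      rw [zpow_neg, zpow_natCast, ← Complex.I_sq, ← pow_mul, mul_comm 2, pow_mul, pow_two,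
        inv_mul_cancel_left₀ (pow_ne_zero _ Complex.I_ne_zero)]
    rw [legendreInt_neg_natCast]
    push_cast
    rw [← mul_assoc, hI]
    simp [sphericalY, legendreNat, rodrigues]

/-! ### Bessel functions of integer order -/

/-- The entire function `E_n` with `J_n(x) = (x/2)^n E_n(x²/4)`. -/
noncomputable def besselE (n : ℕ) (y : ℝ) : ℝ :=
  ∑' k : ℕ, (-1) ^ k / (k.factorial * (k + n).factorial) * y ^ k

theorem abs_besselE_coeff_le (n k : ℕ) :
    |(-1 : ℝ) ^ k / (k.factorial * (k + n).factorial)| ≤ 1 / k.factorial := by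
  rw [abs_div, abs_pow, abs_neg, abs_one, one_pow, abs_of_nonneg (by positivity)]
  have h1 : (1 : ℝ) ≤ (k + n).factorial := by exact_mod_cast Nat.factorial_pos _
  have h2 : (0 : ℝ) < k.factorial := by positivity
  gcongr
  nlinarith

theorem summable_besselE (n : ℕ) (y : ℝ) :
    Summable fun k : ℕ => (-1 : ℝ) ^ k / (k.factorial * (k + n).factorial) * y ^ k := by
  refine Summable.of_norm_bounded (Real.summable_pow_div_factorial |y|) fun k => ?_
  rw [Real.norm_eq_abs, abs_mul, abs_pow]
  refine (mul_le_mul_of_nonneg_right (abs_besselE_coeff_le n k) (by positivity)).trans_eq ?_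
  rw [one_div_mul_eq_div]

theorem hasDerivAt_besselE (n : ℕ) (y : ℝ) : HasDerivAt (besselE n) (-besselE (n + 1) y) y := by
  obtain ⟨M, hyM⟩ : ∃ M, |y| < M := exists_gt _
  have hM : 0 < M := (abs_nonneg y).trans_lt hyM
  have hu : Summable fun k : ℕ => (k : ℝ) * M ^ (k - 1) / k.factorial := by
    rw [← summable_nat_add_iff 1]
    refine (Real.summable_pow_div_factorial M).congr fun k => ?_
    rw [Nat.factorial_succ, Nat.add_sub_cancel]
    push_cast
    field_simp
  have h := hasDerivAt_tsum_of_isPreconnected (t := Metric.ball (0 : ℝ) M) (y₀ := 0) (y := y)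
    (g := fun k y => (-1 : ℝ) ^ k / (k.factorial * (k + n).factorial) * y ^ k)
    (g' := fun k y => (-1 : ℝ) ^ k / (k.factorial * (k + n).factorial) * (k * y ^ (k - 1)))
    hu Metric.isOpen_ball (convex_ball _ _).isPreconnected
    (fun k z _ => (hasDerivAt_pow k z).const_mul _) (fun k z hz => ?_)
    (Metric.mem_ball_self hM) (summable_besselE n 0)
    (by rwa [mem_ball_zero_iff, Real.norm_eq_abs])
  · refine h.congr_deriv ?_
    have hs : Summable fun k : ℕ =>
        (-1 : ℝ) ^ k / (k.factorial * (k + n).factorial) * (k * y ^ (k - 1)) := by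
      rw [← summable_nat_add_iff 1]
      refine (summable_besselE (n + 1) y).neg.congr fun k => ?_
      rw [Nat.factorial_succ k, show k + 1 + n = k + (n + 1) by ring, Nat.add_sub_cancel]
      push_cast
      field_simp
      ring
    rw [hs.tsum_eq_zero_add, besselE, ← tsum_neg]
    simp only [Nat.cast_zero, zero_mul, mul_zero, zero_add]
    refine tsum_congr fun k => ?_
    rw [Nat.factorial_succ k, show k + 1 + n = k + (n + 1) by ring, Nat.add_sub_cancel]
    push_cast
    field_simp
    ring
  · have hz : |z| ≤ M := by simpa using (mem_ball_zero_iff.1 hz).le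
    rw [Real.norm_eq_abs, abs_mul, abs_mul, abs_pow, Nat.abs_cast]
    refine (mul_le_mul_of_nonneg_right (abs_besselE_coeff_le n k) (by positivity)).trans ?_
    rw [one_div_mul_eq_div]
    gcongr

theorem besselE_three_term (n : ℕ) (y : ℝ) :
    (n + 1) * besselE (n + 1) y = besselE n y + y * besselE (n + 2) y := by
  have h0 := summable_besselE n y
  have h1 := summable_besselE (n + 1) y
  have h2 := summable_besselE (n + 2) y
  -- the series of `y E_{n+2}`, with its index shifted by one
  have h3 : HasSum (fun k : ℕ => -(k * ((-1 : ℝ) ^ k / (k.factorial * (k + (n + 1)).factorial) *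
      y ^ k))) (y * besselE (n + 2) y) := by
    rw [← hasSum_nat_add_iff' 1]
    simp only [Finset.range_one, Finset.sum_singleton, Nat.cast_zero, zero_mul, neg_zero, sub_zero]
    refine (h2.hasSum.mul_left y).congr_fun fun k => ?_
    rw [Nat.factorial_succ k, show k + 1 + (n + 1) = k + (n + 2) by ring]
    push_cast
    field_simp
    ring
  refine ((h1.hasSum.mul_left ((n : ℝ) + 1)).unique ((h0.hasSum.add h3).congr_fun fun k => ?_))
  rw [← add_assoc, Nat.factorial_succ (k + n)]
  push_cast
  field_simp
  ring

theorem besselJNat_eq (n : ℕ) (x : ℝ) : besselJNat n x = (x / 2) ^ n * besselE n (x ^ 2 / 4) := by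
  rw [besselJNat, besselE, ← tsum_mul_left]
  refine tsum_congr fun k => ?_
  rw [pow_add, pow_mul, div_pow x 2 2]
  norm_num
  ring

theorem hasDerivAt_besselJNat (n : ℕ) {x : ℝ} (hx : x ≠ 0) :
    HasDerivAt (besselJNat n) (n / x * besselJNat n x - besselJNat (n + 1) x) x := by
  have h1 : HasDerivAt (fun x : ℝ => x ^ 2 / 4) (2 * x / 4) x := by
    simpa using (hasDerivAt_pow 2 x).div_const 4
  have h2 : HasDerivAt (fun x : ℝ => (x / 2) ^ n) (n * (x / 2) ^ (n - 1) * (1 / 2)) x :=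
    ((hasDerivAt_id x).div_const 2).pow n
  have h := h2.mul ((hasDerivAt_besselE n (x ^ 2 / 4)).comp x h1)
  refine (h.congr_of_eventuallyEq (.of_forall fun x => besselJNat_eq n x)).congr_deriv ?_
  simp only [besselJNat_eq, Function.comp]
  rcases n with _ | n
  · simp
    ring
  · rw [Nat.add_sub_cancel]
    simp only [pow_succ]
    field_simp
    ring

theorem besselJNat_three_term (n : ℕ) {x : ℝ} (hx : x ≠ 0) :
    2 * (n + 1 : ℕ) / x * besselJNat (n + 1) x = besselJNat (n + 2) x + besselJNat n x := by
  have h := besselE_three_term n (x ^ 2 / 4)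
  simp only [besselJNat_eq, pow_succ]
  push_cast
  field_simp
  linear_combination 4 * h

@[simp] theorem besselJ_natCast (n : ℕ) : besselJ n = besselJNat n := by
  funext x
  simp [besselJ]

@[simp] theorem besselJ_neg_natCast (n : ℕ) (x : ℝ) :
    besselJ (-(n : ℤ)) x = (-1) ^ n * besselJNat n x := by
  rcases n with _ | n
  · simp [besselJ]
  · rw [besselJ, if_neg (by omega), Int.natAbs_neg, Int.natAbs_natCast]

theorem besselJ_neg (m : ℤ) (x : ℝ) : besselJ (-m) x = (-1) ^ m.natAbs * besselJ m x := by
  obtain ⟨n, rfl | rfl⟩ := m.eq_nat_or_neg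
  · simp
  · have : (-1 : ℝ) ^ n * (-1) ^ n = 1 := by rw [← mul_pow]; simp
    simp [← mul_assoc, this]

theorem besselJ_three_term (m : ℤ) {x : ℝ} (hx : x ≠ 0) :
    2 * m / x * besselJ m x = besselJ (m + 1) x + besselJ (m - 1) x := by
  have h1 := besselJ_neg_natCast 1 x
  have h2 := besselJ_natCast 1
  push_cast at h1 h2
  obtain ⟨n, rfl | rfl⟩ := m.eq_nat_or_neg <;> rcases n with _ | n
  · simp [h1, h2]
  · have h := besselJNat_three_term n hx
    have e1 : ((n + 1 : ℕ) : ℤ) + 1 = (n + 2 : ℕ) := by push_cast; ring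
    have e2 : ((n + 1 : ℕ) : ℤ) - 1 = (n : ℕ) := by push_cast; ring
    rw [e1, e2]
    simpa only [besselJ_natCast, Int.cast_natCast] using h
  · simp [h1, h2]
  · have h := besselJNat_three_term n hx
    have e1 : -((n + 1 : ℕ) : ℤ) + 1 = -(n : ℕ) := by push_cast; ring
    have e2 : -((n + 1 : ℕ) : ℤ) - 1 = -(n + 2 : ℕ) := by push_cast; ring
    rw [e1, e2]
    simp only [besselJ_neg_natCast]
    push_cast at h ⊢
    simp only [pow_succ]
    linear_combination (-1) ^ n * h

theorem hasDerivAt_besselJ (m : ℤ) {x : ℝ} (hx : x ≠ 0) :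
    HasDerivAt (besselJ m) (m / x * besselJ m x - besselJ (m + 1) x) x := by
  obtain ⟨n, rfl | rfl⟩ := m.eq_nat_or_neg
  · have e1 : (n : ℤ) + 1 = (n + 1 : ℕ) := by push_cast; ring
    rw [e1]
    simpa only [besselJ_natCast, Int.cast_natCast] using hasDerivAt_besselJNat n hx
  · have h := (hasDerivAt_besselJNat n hx).const_mul ((-1 : ℝ) ^ n)
    have h3 := besselJ_three_term (-(n : ℤ)) hx
    have e1 : -(n : ℤ) - 1 = -(n + 1 : ℕ) := by push_cast; ring
    refine (h.congr_of_eventuallyEq (.of_forall fun x => ?_)).congr_deriv ?_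
    · exact besselJ_neg_natCast n x
    · rw [e1] at h3
      simp only [besselJ_neg_natCast] at h3 ⊢
      push_cast at h3 ⊢
      simp only [pow_succ] at h3
      linear_combination -h3

theorem continuous_besselE (n : ℕ) : Continuous (besselE n) :=
  continuous_iff_continuousAt.2 fun y => (hasDerivAt_besselE n y).continuousAt

theorem continuous_besselJNat (n : ℕ) : Continuous (besselJNat n) := by
  have := continuous_besselE n
  rw [show besselJNat n = _ from funext (besselJNat_eq n)]
  fun_prop

theorem continuous_besselJ (m : ℤ) : Continuous (besselJ m) := by
  have := continuous_besselJNat m.natAbs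
  unfold besselJ
  split_ifs <;> fun_prop

/-- Near `0` the first term of the series dominates. -/
theorem exists_besselJ_ne_zero (m : ℤ) : ∃ x, 0 < x ∧ besselJ m x ≠ 0 := by
  have h0 : besselE m.natAbs 0 ≠ 0 := by
    rw [besselE, tsum_eq_single 0 (fun k hk => by simp [hk])]
    simp [Nat.factorial_ne_zero]
  have hc : Tendsto (fun x : ℝ => besselE m.natAbs (x ^ 2 / 4)) (𝓝[>] 0)
      (𝓝 (besselE m.natAbs 0)) := by
    have : Continuous fun x : ℝ => besselE m.natAbs (x ^ 2 / 4) := by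
      have := continuous_besselE m.natAbs
      fun_prop
    simpa using (this.tendsto 0).mono_left nhdsWithin_le_nhds
  obtain ⟨x, hx, hx0⟩ := ((hc.eventually_ne h0).and self_mem_nhdsWithin).exists
  have hx0 : 0 < x := hx0
  refine ⟨x, hx0, ?_⟩
  have : besselJNat m.natAbs x ≠ 0 := by
    rw [besselJNat_eq]
    exact mul_ne_zero (by positivity) hx
  rw [besselJ]
  split_ifs
  · exact this
  · exact mul_ne_zero (by simp) this

/-! ### The Mehler–Heine limit -/

/-- The quotient of `(l + j)! / (l - j)! = ∏_{i < j} (l - i)(l + i + 1)` by `(l(l + 1))^j`, which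
is `0` for `j > l`. -/
noncomputable def factorialRatio (l j : ℕ) : ℝ :=
  ∏ i ∈ Finset.range j, ((l - i) * (l + i + 1)) / (l * (l + 1) : ℝ)

theorem factorialRatio_eq_zero {l j : ℕ} (h : l < j) : factorialRatio l j = 0 :=
  Finset.prod_eq_zero (Finset.mem_range.2 h) (by simp)

theorem factorialRatio_eq {l j : ℕ} (hl : 0 < l) (h : j ≤ l) :
    factorialRatio l j = (l + j).factorial / ((l - j).factorial * (l * (l + 1)) ^ j) := by
  induction j with
  | zero =>
    have : (l.factorial : ℝ) ≠ 0 := by positivity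
    simp [factorialRatio, this]
  | succ j ih =>
    rw [factorialRatio, Finset.prod_range_succ, ← factorialRatio, ih (by omega)]
    obtain ⟨k, rfl⟩ : ∃ k, l = j + 1 + k := ⟨l - (j + 1), by omega⟩
    rw [show j + 1 + k - j = k + 1 by omega, show j + 1 + k - (j + 1) = k by omega,
      show j + 1 + k + (j + 1) = (j + 1 + k + j) + 1 by ring, Nat.factorial_succ k,
      Nat.factorial_succ (j + 1 + k + j)]
    push_cast
    field_simp
    ring

theorem factorialRatio_nonneg (l j : ℕ) : 0 ≤ factorialRatio l j := by
  rcases lt_or_ge l j with h | h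
  · rw [factorialRatio_eq_zero h]
  · refine Finset.prod_nonneg fun i hi => ?_
    have : (0 : ℝ) ≤ l - i :=
      sub_nonneg.2 (by exact_mod_cast (Finset.mem_range.1 hi).le.trans h)
    positivity

theorem factorialRatio_le_one (l j : ℕ) : factorialRatio l j ≤ 1 := by
  rcases lt_or_ge l j with h | h
  · rw [factorialRatio_eq_zero h]
    exact zero_le_one
  · refine Finset.prod_le_one (fun i hi => ?_) fun i hi => ?_
    · have : (0 : ℝ) ≤ l - i :=
        sub_nonneg.2 (by exact_mod_cast (Finset.mem_range.1 hi).le.trans h)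
      positivity
    · refine div_le_one_of_le₀ ?_ (by positivity)
      have : (0 : ℝ) ≤ i := by positivity
      nlinarith

theorem tendsto_factorialRatio (j : ℕ) :
    Tendsto (fun l => factorialRatio l j) atTop (𝓝 1) := by
  have h0 := tendsto_inv_atTop_nhds_zero_nat (𝕜 := ℝ)
  rw [← Finset.prod_const_one (s := Finset.range j)]
  refine tendsto_finsetProd _ fun i _ => ?_
  have h : Tendsto (fun l : ℕ => (1 - i * (l : ℝ)⁻¹) * (1 + (i + 1) * (l : ℝ)⁻¹) /
      (1 + (l : ℝ)⁻¹)) atTop (𝓝 ((1 - i * 0) * (1 + (i + 1) * 0) / (1 + 0))) :=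
    ((tendsto_const_nhds.sub (h0.const_mul _)).mul (tendsto_const_nhds.add (h0.const_mul _))).div
      (tendsto_const_nhds.add h0) (by norm_num)
  norm_num at h
  refine h.congr' ?_
  filter_upwards [eventually_gt_atTop 0] with l hl
  field_simp
  ring

/-- The expansion of `P_l^(n)` at `z = 1`, written as an infinite series with finitely many nonzero
terms. -/
theorem rodrigues_div_eq_tsum {l n : ℕ} (hl : 0 < l) (h : n ≤ l) (z : ℝ) :
    rodrigues l (l + n) z / (2 ^ l * l.factorial) = ∑' k : ℕ,
      (l * (l + 1)) ^ (n + k) * factorialRatio l (n + k) /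
        ((n + k).factorial * k.factorial * 2 ^ (n + k)) * (z - 1) ^ k := by
  rw [tsum_eq_sum (s := Finset.range (l + 1 - n)), rodrigues_eq_sum, Finset.sum_div]
  swap
  · intro k hk
    rw [factorialRatio_eq_zero (by rw [Finset.mem_range] at hk; omega)]
    simp
  rw [show l + 1 = n + (l + 1 - n) by omega, Finset.sum_range_add, Finset.sum_eq_zero, zero_add,
    show n + (l + 1 - n) - n = l + 1 - n by omega]
  · refine Finset.sum_congr rfl fun k hk => ?_
    have hk : n + k ≤ l := by rw [Finset.mem_range] at hk; omega
    have h1 : (l.choose (n + k) : ℝ) =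
        l.factorial / ((n + k).factorial * (l - (n + k)).factorial) :=
      Nat.cast_choose ℝ hk
    have h2 : ((l + (n + k)).descFactorial (l + n) : ℝ) = (l + (n + k)).factorial / k.factorial := by
      rw [eq_div_iff (by positivity), mul_comm]
      have := Nat.factorial_mul_descFactorial (show l + n ≤ l + (n + k) by omega)
      rw [show l + (n + k) - (l + n) = k by omega] at this
      exact_mod_cast this
    have h3 : (2 : ℝ) ^ l = 2 ^ (l - (n + k)) * 2 ^ (n + k) := by
      rw [← pow_add]; congr 1; omega
    rw [h1, h2, factorialRatio_eq hl hk, h3, show l + (n + k) - (l + n) = k by omega]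
    field_simp
  · intro j hj
    rw [Nat.descFactorial_of_lt (by have := Finset.mem_range.1 hj; omega)]
    simp

/-- The expansion of `Y_l^n` at the pole, in a form that converges term by term to the series of
`J_n` when `θ = x / l`. -/
theorem legendreNat_eq_tsum {l n : ℕ} (hl : 0 < l) (h : n ≤ l) (θ : ℝ) :
    legendreNat l n θ = Real.sqrt (1 / factorialRatio l n) *
      (Real.sqrt (l * (l + 1)) * Real.sin θ / 2) ^ n *
      ∑' k : ℕ, (-1) ^ k / (k.factorial * (k + n).factorial) *
        (factorialRatio l (n + k) * (l * (l + 1) * Real.sin (θ / 2) ^ 2) ^ k) := by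
  have hc : Real.cos θ - 1 = -2 * Real.sin (θ / 2) ^ 2 := by
    have := Real.cos_two_mul' (θ / 2)
    rw [mul_div_cancel₀ _ two_ne_zero, Real.cos_sq'] at this
    linarith
  -- the normalization absorbs `(l(l + 1))^n` up to the ratio of factorials
  have hs : Real.sqrt ((l - n).factorial / (l + n).factorial) * Real.sqrt (l * (l + 1)) ^ n
      = Real.sqrt (1 / factorialRatio l n) := by
    have hsq : 1 / factorialRatio l n = (Real.sqrt ((l - n).factorial / (l + n).factorial) *
        Real.sqrt (l * (l + 1)) ^ n) ^ 2 := by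
      rw [mul_pow, ← pow_mul, mul_comm n, pow_mul, Real.sq_sqrt (by positivity),
        Real.sq_sqrt (by positivity), factorialRatio_eq hl h]
      field_simp
    rw [hsq, Real.sqrt_sq (by positivity)]
  rw [legendreNat, rodrigues_div_eq_tsum hl h, hc, ← hs, ← tsum_mul_left, ← tsum_mul_left]
  refine tsum_congr fun k => ?_
  have hu : Real.sqrt (l * (l + 1)) * Real.sqrt (l * (l + 1)) = (l * (l + 1) : ℝ) :=
    Real.mul_self_sqrt (by positivity)
  generalize Real.sqrt (l * (l + 1)) = u at hu ⊢
  rw [← hu, add_comm k n]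
  rw [pow_add 2 n k, neg_mul, neg_eq_neg_one_mul, mul_pow (-1), mul_pow 2, div_pow, mul_pow u]
  have h2 : (2 : ℝ) ^ k ≠ 0 := by positivity
  field_simp
  ring

/-- The Mehler–Heine limit: the terms of the series converge, and are dominated by those of the
exponential series of `x² / 2`. -/
theorem tendsto_legendreNat (n : ℕ) (x : ℝ) :
    Tendsto (fun l : ℕ => legendreNat l n (x / l)) atTop (𝓝 (besselJNat n x)) := by
  have h0 := tendsto_inv_atTop_nhds_zero_nat (𝕜 := ℝ)
  -- `l sin(c / l) → c`
  have hsin : ∀ c : ℝ, Tendsto (fun l : ℕ => l * Real.sin (c / l)) atTop (𝓝 c) := by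
    intro c
    have h1 : Tendsto (fun l : ℕ => c * Real.sinc (c * (l : ℝ)⁻¹)) atTop
        (𝓝 (c * Real.sinc (c * 0))) :=
      ((Real.continuous_sinc.tendsto _).comp (h0.const_mul c)).const_mul c
    rw [mul_zero, Real.sinc_zero, mul_one] at h1
    refine h1.congr' ?_
    filter_upwards [eventually_gt_atTop 0] with l hl
    rcases eq_or_ne c 0 with rfl | hc
    · simp
    · rw [Real.sinc_of_ne_zero (by positivity), ← div_eq_mul_inv]
      field_simp
  have hu : Tendsto (fun l : ℕ => 1 + (l : ℝ)⁻¹) atTop (𝓝 1) := by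
    simpa using h0.const_add 1
  have hu' : ∀ l : ℕ, 0 < l → (l * (l + 1) : ℝ) = (1 + (l : ℝ)⁻¹) * (l * l) := by
    intro l hl
    field_simp
  have ht1 : Tendsto (fun l : ℕ => Real.sqrt (l * (l + 1)) * Real.sin (x / l) / 2) atTop
      (𝓝 (x / 2)) := by
    have := ((Real.continuous_sqrt.tendsto _).comp hu).mul (hsin x)
    rw [Real.sqrt_one, one_mul] at this
    refine (this.div_const 2).congr' ?_
    filter_upwards [eventually_gt_atTop 0] with l hl
    rw [hu' l hl, Real.sqrt_mul (by positivity), Real.sqrt_mul_self (by positivity)]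
    simp only [Function.comp]
    ring
  have ht2 : Tendsto (fun l : ℕ => l * (l + 1) * Real.sin (x / l / 2) ^ 2) atTop
      (𝓝 ((x / 2) ^ 2)) := by
    have := hu.mul ((hsin (x / 2)).pow 2)
    rw [one_mul] at this
    refine this.congr' ?_
    filter_upwards [eventually_gt_atTop 0] with l hl
    rw [hu' l hl, div_right_comm]
    ring
  have hbound : ∀ l : ℕ, 0 < l → l * (l + 1) * Real.sin (x / l / 2) ^ 2 ≤ x ^ 2 / 2 := by
    intro l hl
    have h1 : Real.sin (x / l / 2) ^ 2 ≤ (x / l / 2) ^ 2 := by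
      rw [sq_le_sq]
      exact Real.abs_sin_le_abs
    have hl1 : (1 : ℝ) ≤ l := by exact_mod_cast hl
    calc l * (l + 1) * Real.sin (x / l / 2) ^ 2 ≤ l * (l + l) * (x / l / 2) ^ 2 := by gcongr
      _ = x ^ 2 / 2 := by field_simp; ring
  have hT : Tendsto (fun l : ℕ => ∑' k : ℕ, (-1) ^ k / (k.factorial * (k + n).factorial) *
        (factorialRatio l (n + k) * (l * (l + 1) * Real.sin (x / l / 2) ^ 2) ^ k)) atTop
      (𝓝 (∑' k : ℕ, (-1) ^ k / (k.factorial * (k + n).factorial) * (1 * ((x / 2) ^ 2) ^ k))) := by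
    refine tendsto_tsum_of_dominated_convergence
      (Real.summable_pow_div_factorial (x ^ 2 / 2)) (fun k => ?_) ?_
    · exact ((tendsto_factorialRatio (n + k)).mul (ht2.pow k)).const_mul _
    · filter_upwards [eventually_gt_atTop 0] with l hl k
      rw [Real.norm_eq_abs, abs_mul, abs_of_nonneg (a := factorialRatio l (n + k) * _)
        (mul_nonneg (factorialRatio_nonneg _ _) (by positivity))]
      calc _ ≤ 1 / (k.factorial : ℝ) * (1 * (x ^ 2 / 2) ^ k) := by
            have := factorialRatio_nonneg l (n + k)
            gcongr
            · exact abs_besselE_coeff_le n k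
            · exact factorialRatio_le_one _ _
            · exact hbound l hl
        _ = _ := by ring
  have hR : Tendsto (fun l : ℕ => Real.sqrt (1 / factorialRatio l n)) atTop (𝓝 1) := by
    have := (Real.continuous_sqrt.tendsto (1 / 1)).comp
      ((tendsto_const_nhds (x := (1 : ℝ))).div (tendsto_factorialRatio n) one_ne_zero)
    rwa [div_one, Real.sqrt_one] at this
  have h := (hR.mul (ht1.pow n)).mul hT
  have he : besselJNat n x = 1 * (x / 2) ^ n *
      ∑' k : ℕ, (-1) ^ k / (k.factorial * (k + n).factorial) * (1 * ((x / 2) ^ 2) ^ k) := by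
    simp only [one_mul]
    rw [besselJNat_eq, besselE, div_pow x 2 2]
    norm_num
  rw [he]
  refine h.congr' ?_
  filter_upwards [eventually_gt_atTop 0, eventually_ge_atTop n] with l hl hn
  rw [legendreNat_eq_tsum hl hn]

theorem tendsto_legendreInt (m : ℤ) (x : ℝ) :
    Tendsto (fun l : ℕ => legendreInt l m (x / l)) atTop (𝓝 (besselJ m x)) := by
  have h := tendsto_legendreNat m.natAbs x
  unfold legendreInt besselJ
  split_ifs
  · exact h
  · exact h.const_mul _

theorem tendsto_sphericalY (R : ℝ) (m : ℤ) (θ φ : ℝ) :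
    Tendsto (fun l : ℕ+ => sphericalY l m (eps R l * θ) φ) atTop
      (𝓝 (Complex.I ^ m * (besselJ m (R * θ) : ℂ) * Complex.exp (-(Complex.I * m * φ)))) := by
  have h := (Complex.continuous_ofReal.tendsto _).comp ((tendsto_legendreInt m (R * θ)).comp
    tendsto_PNat_val_atTop_atTop)
  refine ((h.const_mul (Complex.I ^ m)).mul_const _).congr fun l => ?_
  rw [sphericalY_eq, eps]
  simp only [Function.comp]
  congr 4
  ring

/-! ### Modes in polar coordinates -/

/-- The function `A(r) e^{ikφ}` on `s × [0, 2π)`, extended by zero. -/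
noncomputable def mode (s : Set ℝ) (A : ℝ → ℂ) (k : ℤ) : ℝ × ℝ → ℂ :=
  (s ×ˢ Set.Ico 0 (2 * Real.pi)).indicator fun p => A p.1 * Complex.exp (Complex.I * k * p.2)

theorem mode_apply {s : Set ℝ} {A : ℝ → ℂ} {k : ℤ} {p : ℝ × ℝ}
    (hp : p ∈ s ×ˢ Set.Ico 0 (2 * Real.pi)) :
    mode s A k p = A p.1 * Complex.exp (Complex.I * k * p.2) :=
  Set.indicator_of_mem hp _

theorem mode_eq_zero {s : Set ℝ} {A : ℝ → ℂ} {k : ℤ} {p : ℝ × ℝ}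
    (hp : p ∉ s ×ˢ Set.Ico 0 (2 * Real.pi)) : mode s A k p = 0 :=
  Set.indicator_of_notMem hp _

theorem hasDerivWithinAt_mode_radial {s : Set ℝ} {A : ℝ → ℂ} {A' : ℂ} {k : ℤ} {p : ℝ × ℝ}
    (hp : p ∈ s ×ˢ Set.Ico 0 (2 * Real.pi)) (hA : HasDerivAt A A' p.1) :
    HasDerivWithinAt (fun x => mode s A k (x, p.2)) (A' * Complex.exp (Complex.I * k * p.2))
      s p.1 := by
  refine (hA.hasDerivWithinAt.mul_const (Complex.exp (Complex.I * k * p.2))).congr_of_mem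
    (fun x hx => ?_) hp.1
  exact mode_apply ⟨hx, hp.2⟩

theorem hasDerivWithinAt_mode_angle {s : Set ℝ} {A : ℝ → ℂ} {k : ℤ} {p : ℝ × ℝ}
    (hp : p ∈ s ×ˢ Set.Ico 0 (2 * Real.pi)) :
    HasDerivWithinAt (fun x => mode s A k (p.1, x)) (Complex.I * k * mode s A k p)
      (Set.Ico 0 (2 * Real.pi)) p.2 := by
  have h1 : HasDerivAt (fun x : ℝ => Complex.I * k * (x : ℂ)) (Complex.I * k) p.2 := by
    simpa using (Complex.ofRealCLM.hasDerivAt (x := p.2)).const_mul (Complex.I * k)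
  have h2 := (h1.cexp.const_mul (A p.1)).hasDerivWithinAt (s := Set.Ico 0 (2 * Real.pi))
  refine (h2.congr_of_mem (fun x hx => ?_) hp.2).congr_deriv ?_
  · exact mode_apply (p := (p.1, x)) ⟨hp.1, hx⟩
  rw [mode_apply hp]
  ring

theorem integral_exp_int (k : ℤ) :
    ∫ x in (0 : ℝ)..(2 * Real.pi), Complex.exp (Complex.I * k * x) =
      if k = 0 then ((2 * Real.pi : ℝ) : ℂ) else 0 := by
  split_ifs with h
  · simp [h]
  · have hk : Complex.I * k ≠ 0 := mul_ne_zero Complex.I_ne_zero (by exact_mod_cast h)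
    rw [integral_exp_mul_complex hk]
    have : Complex.exp (Complex.I * k * ((2 * Real.pi : ℝ) : ℂ)) = 1 := by
      rw [← Complex.exp_int_mul_two_pi_mul_I k]
      push_cast
      ring_nf
    rw [this]
    simp

/-- Modes with distinct angular frequencies are linearly independent: the coefficients are
recovered by integrating over the angle. -/
theorem linearIndependent_mode {ι : Type*} {s : Set ℝ} {A : ι → ℝ → ℂ} {k : ι → ℤ}
    (hk : Function.Injective k) (hA : ∀ i, ∃ r ∈ s, A i r ≠ 0) :
    LinearIndependent ℂ fun i => mode s (A i) (k i) := by
  classical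
  rw [linearIndependent_iff']
  intro t c hc i hi
  obtain ⟨r, hr, hAr⟩ := hA i
  -- multiply the relation by `e^{-i k_i x}`, so that only the `i`-th term has a nonzero mean
  have h1 : ∀ x ∈ Set.Ico 0 (2 * Real.pi),
      ∑ j ∈ t, c j * A j r * Complex.exp (Complex.I * (k j - k i : ℤ) * x) = 0 := by
    intro x hx
    have h2 := congrFun hc (r, x)
    simp only [Finset.sum_apply, Pi.smul_apply, smul_eq_mul, Pi.zero_apply] at h2
    have h3 := congrArg (· * Complex.exp (-(Complex.I * k i * x))) h2
    simp only [Finset.sum_mul, zero_mul] at h3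
    rw [← h3]
    refine Finset.sum_congr rfl fun j _ => ?_
    rw [mode_apply ⟨hr, hx⟩, mul_assoc (c j), mul_assoc (c j), mul_assoc (A j r), ← Complex.exp_add]
    push_cast
    ring_nf
  have h2 : ∫ x in (0 : ℝ)..(2 * Real.pi),
      ∑ j ∈ t, c j * A j r * Complex.exp (Complex.I * (k j - k i : ℤ) * x) = 0 := by
    rw [intervalIntegral.integral_of_le (by positivity), ← integral_Ico_eq_integral_Ioc,
      setIntegral_congr_fun measurableSet_Ico h1]
    simp
  rw [intervalIntegral.integral_finsetSum fun j _ =>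
    Continuous.intervalIntegrable (by fun_prop) _ _] at h2
  simp only [intervalIntegral.integral_const_mul, integral_exp_int] at h2
  rw [Finset.sum_eq_single_of_mem i hi] at h2
  · have : (Real.pi : ℂ) ≠ 0 := by exact_mod_cast Real.pi_ne_zero
    simpa [hAr, this] using h2
  · intro j _ hj
    rw [if_neg (by rw [sub_eq_zero]; exact fun h => hj (hk h)), mul_zero]

/-- `f` vanishes outside `s × [0, 2π)` and is continuous in the radial variable at `0`. -/
def IsRadiallyContinuous (s : Set ℝ) (f : ℝ × ℝ → ℂ) : Prop :=
  (∀ p ∉ s ×ˢ Set.Ico 0 (2 * Real.pi), f p = 0) ∧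
    ∀ x ∈ Set.Ico 0 (2 * Real.pi), Tendsto (fun r => f (r, x)) (𝓝[>] 0) (𝓝 (f (0, x)))

theorem isRadiallyContinuous_mode {s : Set ℝ} (hs : s ∈ 𝓝[≥] (0 : ℝ)) {A : ℝ → ℂ}
    (hA : Continuous A) (k : ℤ) : IsRadiallyContinuous s (mode s A k) := by
  refine ⟨fun p hp => mode_eq_zero hp, fun x hx => ?_⟩
  rw [mode_apply ⟨mem_of_mem_nhdsWithin Set.self_mem_Ici hs, hx⟩]
  have h1 : Tendsto (fun r => A r * Complex.exp (Complex.I * k * x)) (𝓝[>] 0)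
      (𝓝 (A 0 * Complex.exp (Complex.I * k * x))) :=
    ((hA.tendsto 0).mono_left nhdsWithin_le_nhds).mul_const _
  refine h1.congr' ?_
  filter_upwards [nhdsWithin_mono _ Set.Ioi_subset_Ici_self hs] with r hr
  rw [mode_apply ⟨hr, hx⟩]

theorem isRadiallyContinuous_of_mem_span {s : Set ℝ} {S : Set (ℝ × ℝ → ℂ)}
    (hS : ∀ f ∈ S, IsRadiallyContinuous s f) {f : ℝ × ℝ → ℂ} (hf : f ∈ Submodule.span ℂ S) :
    IsRadiallyContinuous s f := by
  induction hf using Submodule.span_induction with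
  | mem f h => exact hS f h
  | zero => exact ⟨fun _ _ => rfl, fun _ _ => tendsto_const_nhds⟩
  | add f g _ _ hf hg =>
    refine ⟨fun p hp => ?_, fun x hx => (hf.2 x hx).add (hg.2 x hx)⟩
    rw [Pi.add_apply, hf.1 p hp, hg.1 p hp, add_zero]
  | smul c f _ hf =>
    refine ⟨fun p hp => ?_, fun x hx => (hf.2 x hx).const_mul c⟩
    rw [Pi.smul_apply, hf.1 p hp, smul_zero]

/-- By continuity, the values for `r > 0` determine the function. -/
theorem IsRadiallyContinuous.ext {s : Set ℝ} (hs : s ⊆ Set.Ici 0) (hs' : s ∈ 𝓝[≥] (0 : ℝ))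
    {f g : ℝ × ℝ → ℂ}
    (hf : IsRadiallyContinuous s f) (hg : IsRadiallyContinuous s g)
    (h : ∀ p ∈ s ×ˢ Set.Ico 0 (2 * Real.pi), 0 < p.1 → f p = g p) : f = g := by
  funext p
  by_cases hp : p ∈ s ×ˢ Set.Ico 0 (2 * Real.pi)
  swap
  · rw [hf.1 p hp, hg.1 p hp]
  rcases (Set.mem_Ici.1 (hs hp.1)).eq_or_lt with h0 | h0
  · obtain ⟨r, x⟩ := p
    obtain rfl : (0 : ℝ) = r := h0
    refine tendsto_nhds_unique ((hf.2 x hp.2).congr' ?_) (hg.2 x hp.2)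
    filter_upwards [nhdsWithin_mono _ Set.Ioi_subset_Ici_self hs', self_mem_nhdsWithin] with r hr hr0
    exact h (r, x) ⟨hr, hp.2⟩ hr0
  · exact h p hp h0

/-! ### Bases -/

theorem mem_disc_one_iff {ε : ℝ} (hε : 0 < ε) (p : ℝ × ℝ) :
    (ε * p.1, p.2) ∈ disc 1 ↔ p ∈ disc ε := by
  simp only [disc, Set.mem_prod, Set.mem_Ico, div_one, lt_div_iff₀' hε,
    mul_nonneg_iff_of_pos_left hε]

theorem chi_eq_mode (l : ℕ) {ε : ℝ} (hε : 0 < ε) (m : ℤ) :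
    chi l ε m = mode (Set.Ico 0 (Real.pi / ε))
      (fun r => Complex.I ^ m * (legendreInt l m (ε * r) : ℂ)) (-m) := by
  funext p
  change (disc 1).indicator (fun p : ℝ × ℝ => sphericalY l m p.1 p.2) (ε * p.1, p.2) = _
  by_cases hp : p ∈ disc ε
  · rw [Set.indicator_of_mem ((mem_disc_one_iff hε p).2 hp), mode_apply hp, sphericalY_eq]
    push_cast
    ring_nf
  · rw [Set.indicator_of_notMem (fun h => hp ((mem_disc_one_iff hε p).1 h)), mode_eq_zero hp]

theorem besselMode_eq_mode (R : ℝ) (m : ℤ) :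
    besselMode R m = mode (Set.Ici 0)
      (fun r => Complex.I ^ m * (besselJ m (R * r) : ℂ)) m := rfl

theorem chi_eq_zero {l : ℕ} {ε : ℝ} (hε : 0 < ε) {m : ℤ} (h : l < m.natAbs) :
    chi l ε m = 0 := by
  funext p
  rw [chi_eq_mode l hε, mode]
  simp [legendreInt_eq_zero h]

theorem dilatedHarm_eq_span (l : ℕ) (ε : ℝ) : dilatedHarm l ε =
    Submodule.span ℂ (Set.range fun m : Set.Icc (-(l : ℤ)) l => chi l ε m) := by
  rw [dilatedHarm, sphHarm, Submodule.map_span, Set.image_image, Set.image_eq_range]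
  rfl

theorem mem_Icc_iff_natAbs {l : ℕ} {m : ℤ} :
    m ∈ Set.Icc (-(l : ℤ)) l ↔ m.natAbs ≤ l := by
  rw [Set.mem_Icc]
  omega

theorem chi_mem (l : ℕ) {ε : ℝ} (hε : 0 < ε) (m : ℤ) : chi l ε m ∈ dilatedHarm l ε := by
  by_cases h : m.natAbs ≤ l
  · rw [dilatedHarm_eq_span]
    exact Submodule.subset_span ⟨⟨m, mem_Icc_iff_natAbs.2 h⟩, rfl⟩
  · rw [chi_eq_zero hε (not_le.1 h)]
    exact zero_mem _

/-- `χ_l^m` as an element of `V_l`; it is zero for `|m| > l`. -/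
noncomputable def chiVec (l : ℕ) {ε : ℝ} (hε : 0 < ε) (m : ℤ) : dilatedHarm l ε :=
  ⟨chi l ε m, chi_mem l hε m⟩

theorem chiVec_eq_zero {l : ℕ} {ε : ℝ} (hε : 0 < ε) {m : ℤ} (h : l < m.natAbs) :
    chiVec l hε m = 0 := Subtype.ext (chi_eq_zero hε h)

theorem linearIndependent_chi (l : ℕ) {ε : ℝ} (hε : 0 < ε) :
    LinearIndependent ℂ fun m : Set.Icc (-(l : ℤ)) l => chi l ε m := by
  have h : (fun m : Set.Icc (-(l : ℤ)) l => chi l ε m) = fun m : Set.Icc (-(l : ℤ)) l =>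
      mode (Set.Ico 0 (Real.pi / ε))
        (fun r => Complex.I ^ (m : ℤ) * (legendreInt l m (ε * r) : ℂ)) (-m) :=
    funext fun m => chi_eq_mode l hε m
  rw [h]
  refine linearIndependent_mode (fun a b hab => Subtype.ext (neg_injective hab)) fun m => ?_
  by_contra! hc
  -- otherwise the integral of `g_m² sin` would vanish
  have h0 : ∀ θ ∈ Set.Ico 0 Real.pi, legendreInt l m θ ^ 2 * Real.sin θ = 0 := by
    intro θ hθ
    have := hc (θ / ε) ⟨div_nonneg hθ.1 hε.le, by gcongr; exact hθ.2⟩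
    rw [mul_div_cancel₀ _ hε.ne', mul_eq_zero] at this
    have h1 : legendreInt l m θ = 0 := by
      simpa using this.resolve_left (zpow_ne_zero _ Complex.I_ne_zero)
    simp [h1]
  have h1 := integral_legendreInt_sq (mem_Icc_iff_natAbs.1 m.2)
  rw [intervalIntegral.integral_of_le Real.pi_pos.le, ← integral_Ico_eq_integral_Ioc,
    setIntegral_congr_fun measurableSet_Ico h0] at h1
  have : (0 : ℝ) < 2 / (2 * l + 1) := by positivity
  simp at h1
  linarith

/-- The basis `χ_l^m`, `|m| ≤ l`, of `V_l`. -/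
noncomputable def harmBasis (l : ℕ) {ε : ℝ} (hε : 0 < ε) :
    Module.Basis (Set.Icc (-(l : ℤ)) l) ℂ (dilatedHarm l ε) :=
  (Module.Basis.span (linearIndependent_chi l hε)).map
    (LinearEquiv.ofEq _ _ (dilatedHarm_eq_span l ε).symm)

@[simp] theorem harmBasis_apply (l : ℕ) {ε : ℝ} (hε : 0 < ε) (m : Set.Icc (-(l : ℤ)) l) :
    harmBasis l hε m = chiVec l hε m := by
  apply Subtype.ext
  simp [harmBasis, Module.Basis.span_apply, chiVec]

theorem linearIndependent_besselMode {R : ℝ} (hR : 0 < R) :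
    LinearIndependent ℂ (besselMode R) := by
  refine linearIndependent_mode (s := Set.Ici 0) (k := fun m => m)
    (A := fun m r => Complex.I ^ m * (besselJ m (R * r) : ℂ)) Function.injective_id fun m => ?_
  obtain ⟨x, hx, h⟩ := exists_besselJ_ne_zero m
  refine ⟨x / R, (div_pos hx hR).le, ?_⟩
  rw [mul_div_cancel₀ _ hR.ne']
  exact mul_ne_zero (zpow_ne_zero _ Complex.I_ne_zero) (by exact_mod_cast h)

/-- The basis `B_m^R` of `Ω_R`. -/
noncomputable def besselBasis {R : ℝ} (hR : 0 < R) : Module.Basis ℤ ℂ (besselSpace R) :=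
  Module.Basis.span (linearIndependent_besselMode hR)

@[simp] theorem besselBasis_apply {R : ℝ} (hR : 0 < R) (m : ℤ) :
    besselBasis hR m = besselVec R m := by
  exact Module.Basis.span_apply (linearIndependent_besselMode hR) m

theorem isRadiallyContinuous_dilatedHarm {l : ℕ} {ε : ℝ} (hε : 0 < ε) {f : ℝ × ℝ → ℂ}
    (hf : f ∈ dilatedHarm l ε) : IsRadiallyContinuous (Set.Ico 0 (Real.pi / ε)) f := by
  rw [dilatedHarm_eq_span] at hf
  refine isRadiallyContinuous_of_mem_span ?_ hf
  rintro _ ⟨m, rfl⟩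
  simp only [chi_eq_mode l hε]
  have := continuous_legendreInt l m
  exact isRadiallyContinuous_mode (Ico_mem_nhdsGE (by positivity)) (by fun_prop) _

theorem isRadiallyContinuous_besselSpace {R : ℝ} {f : ℝ × ℝ → ℂ}
    (hf : f ∈ besselSpace R) : IsRadiallyContinuous (Set.Ici 0) f := by
  refine isRadiallyContinuous_of_mem_span ?_ hf
  rintro _ ⟨m, rfl⟩
  have := continuous_besselJ m
  rw [besselMode_eq_mode]
  exact isRadiallyContinuous_mode self_mem_nhdsWithin (by fun_prop) _

theorem dilatedHarm_ext {l : ℕ} {ε : ℝ} (hε : 0 < ε) {f g : dilatedHarm l ε}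
    (h : ∀ p ∈ disc ε, 0 < p.1 → (f : ℝ × ℝ → ℂ) p = (g : ℝ × ℝ → ℂ) p) : f = g :=
  Subtype.ext <| (isRadiallyContinuous_dilatedHarm hε f.2).ext (fun _ h => h.1)
    (Ico_mem_nhdsGE (by positivity)) (isRadiallyContinuous_dilatedHarm hε g.2) h

theorem besselSpace_ext {R : ℝ} {f g : besselSpace R}
    (h : ∀ p ∈ plane, 0 < p.1 → (f : ℝ × ℝ → ℂ) p = (g : ℝ × ℝ → ℂ) p) : f = g :=
  Subtype.ext <| (isRadiallyContinuous_besselSpace f.2).ext subset_rfl self_mem_nhdsWithin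
    (isRadiallyContinuous_besselSpace g.2) h

/-! ### Representations by ladder operators -/

/-- Vectors `vec m`, `m ∈ ℤ`, of which those with `m` in the range of `idx` form a basis and the
others are zero, together with numbers `coeff m` attached to the steps between `vec m` and
`vec (m + 1)`. -/
structure LadderSystem (V : Type*) [AddCommGroup V] [Module ℂ V] where
  ι : Type
  basis : Module.Basis ι ℂ V
  idx : ι → ℤ
  vec : ℤ → V
  coeff : ℤ → ℂ
  basis_apply : ∀ i, basis i = vec (idx i)
  boundary : ∀ m ∉ Set.range idx,
    vec m = 0 ∧ coeff (m - 1) • vec (m - 1) = 0 ∧ coeff m • vec (m + 1) = 0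

namespace LadderSystem

variable {V : Type*} [AddCommGroup V] [Module ℂ V] (S : LadderSystem V)

/-- The endomorphism `α E₋ + β E₊ + γ H`, where `E₋` and `E₊` are the ladder operators
`vec m ↦ coeff (m - 1) vec (m - 1)` and `vec m ↦ coeff m vec (m + 1)`, and `H` is
`vec m ↦ m vec m`. -/
noncomputable def op (α β γ : ℂ) : Module.End ℂ V :=
  S.basis.constr ℂ fun i => (α * S.coeff (S.idx i - 1)) • S.vec (S.idx i - 1) +
    (β * S.coeff (S.idx i)) • S.vec (S.idx i + 1) + (γ * S.idx i) • S.vec (S.idx i)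

/-- The formula for basis vectors holds for every `m ∈ ℤ`, because of the boundary conditions. -/
theorem op_vec (α β γ : ℂ) (m : ℤ) :
    S.op α β γ (S.vec m) = (α * S.coeff (m - 1)) • S.vec (m - 1) +
      (β * S.coeff m) • S.vec (m + 1) + (γ * m) • S.vec m := by
  by_cases hm : m ∈ Set.range S.idx
  · obtain ⟨i, rfl⟩ := hm
    rw [← S.basis_apply, op, Module.Basis.constr_basis]
    simp only [S.basis_apply]
  · obtain ⟨h1, h2, h3⟩ := S.boundary m hm
    rw [mul_smul, mul_smul, h1, h2, h3]
    simp

theorem hom_ext {W : Type*} [AddCommGroup W] [Module ℂ W] {f g : V →ₗ[ℂ] W}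
    (h : ∀ i, f (S.vec (S.idx i)) = g (S.vec (S.idx i))) : f = g :=
  S.basis.ext fun i => by rw [S.basis_apply, h]

/-- A representation by operators of the form `α E₋ + β E₊ + γ H`; the last three hypotheses are
the commutation relations. -/
noncomputable def rep {𝔤 : Type*} [LieRing 𝔤] [LieAlgebra ℝ 𝔤] (α β γ : 𝔤 →ₗ[ℝ] ℂ)
    (hα : ∀ x y, α ⁅x, y⁆ = α x * γ y - α y * γ x)
    (hβ : ∀ x y, β ⁅x, y⁆ = β y * γ x - β x * γ y)
    (hγ : ∀ x y, ∀ i, γ ⁅x, y⁆ * S.idx i = (α x * β y - α y * β x) *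
      (S.coeff (S.idx i) ^ 2 - S.coeff (S.idx i - 1) ^ 2)) : Rep 𝔤 V where
  toFun x := S.op (α x) (β x) (γ x)
  map_add x y v := by
    rw [← LinearMap.add_apply]
    congr 1
    refine S.hom_ext fun i => ?_
    simp only [LinearMap.add_apply, op_vec, map_add]
    module
  map_smul c x v := by
    rw [← LinearMap.smul_apply]
    congr 1
    refine S.hom_ext fun i => ?_
    simp only [LinearMap.smul_apply, op_vec, map_smul, Complex.real_smul]
    module
  map_lie x y v := by
    rw [← Module.End.mul_apply, ← Module.End.mul_apply, ← LinearMap.sub_apply]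
    congr 1
    refine S.hom_ext fun i => ?_
    have h := hγ x y i
    simp only [LinearMap.sub_apply, Module.End.mul_apply, op_vec, map_add, map_smul, hα, hβ,
      sub_add_cancel, add_sub_cancel_right]
    rw [h]
    push_cast
    module

end LadderSystem

/-- The spherical harmonics of degree `l`, as a ladder system. -/
noncomputable def harmLadder (l : ℕ) {ε : ℝ} (hε : 0 < ε) : LadderSystem (dilatedHarm l ε) where
  ι := Set.Icc (-(l : ℤ)) l
  basis := harmBasis l hε
  idx := Subtype.val
  vec := chiVec l hε
  coeff m := ladder l m
  basis_apply := harmBasis_apply l hε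
  boundary m hm := by
    rw [Subtype.range_coe, mem_Icc_iff_natAbs, not_le] at hm
    refine ⟨chiVec_eq_zero hε hm, ?_, ?_⟩
    · rcases eq_or_ne m (l + 1) with rfl | h
      · simp [ladder_self]
      · rw [chiVec_eq_zero hε (by omega), smul_zero]
    · rcases eq_or_ne m (-(l : ℤ) - 1) with rfl | h
      · simp [ladder_bot]
      · rw [chiVec_eq_zero hε (by omega), smul_zero]

/-- The Bessel modes, as a ladder system with constant coefficients. -/
noncomputable def besselLadder {R : ℝ} (hR : 0 < R) : LadderSystem (besselSpace R) where
  ι := ℤ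
  basis := besselBasis hR
  idx := id
  vec := besselVec R
  coeff _ := R
  basis_apply := besselBasis_apply hR
  boundary m hm := by simp at hm

/-- The coefficient of the operator `χ^m ↦ a_{m-1} χ^{m-1}` in the action of `Y ∈ su(2)` on the
spherical harmonics. -/
noncomputable def suLower : Su2 →ₗ[ℝ] ℂ where
  toFun Y := (Y 0 - Complex.I * Y 1) / 2
  map_add' x y := by simp; ring
  map_smul' c x := by simp; ring

/-- The coefficient of the operator `χ^m ↦ a_m χ^{m+1}` in the action of `Y ∈ su(2)` on the
spherical harmonics. -/
noncomputable def suRaise : Su2 →ₗ[ℝ] ℂ where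
  toFun Y := -(Y 0 + Complex.I * Y 1) / 2
  map_add' x y := by simp; ring
  map_smul' c x := by simp; ring

/-- The coefficient of the operator `χ^m ↦ m χ^m` in the action of `Y ∈ su(2)` on the spherical
harmonics. -/
noncomputable def suWeight : Su2 →ₗ[ℝ] ℂ where
  toFun Y := Complex.I * Y 2
  map_add' x y := by simp; ring
  map_smul' c x := by simp; ring

/-- The coefficient of the operator `B_m ↦ R B_{m-1}` in the action of `Y ∈ iso(2)` on the Bessel
modes. -/
noncomputable def isoLower : Iso2 →ₗ[ℝ] ℂ where
  toFun Y := -(Complex.I * Y 0 - Y 1) / 2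
  map_add' x y := by simp; ring
  map_smul' c x := by simp; ring

/-- The coefficient of the operator `B_m ↦ R B_{m+1}` in the action of `Y ∈ iso(2)` on the Bessel
modes. -/
noncomputable def isoRaise : Iso2 →ₗ[ℝ] ℂ where
  toFun Y := -(Complex.I * Y 0 + Y 1) / 2
  map_add' x y := by simp; ring
  map_smul' c x := by simp; ring

/-- The coefficient of the operator `B_m ↦ m B_m` in the action of `Y ∈ iso(2)` on the Bessel
modes. -/
noncomputable def isoWeight : Iso2 →ₗ[ℝ] ℂ where
  toFun Y := -(Complex.I * Y 2)
  map_add' x y := by simp; ring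
  map_smul' c x := by simp; ring

theorem suLower_apply (Y : Su2) : suLower Y = (Y 0 - Complex.I * Y 1) / 2 := rfl
theorem suRaise_apply (Y : Su2) : suRaise Y = -(Y 0 + Complex.I * Y 1) / 2 := rfl
theorem suWeight_apply (Y : Su2) : suWeight Y = Complex.I * Y 2 := rfl
theorem isoLower_apply (Y : Iso2) : isoLower Y = -(Complex.I * Y 0 - Y 1) / 2 := rfl
theorem isoRaise_apply (Y : Iso2) : isoRaise Y = -(Complex.I * Y 0 + Y 1) / 2 := rfl
theorem isoWeight_apply (Y : Iso2) : isoWeight Y = -(Complex.I * Y 2) := rfl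

/-- The representation of `su(2)` on `V_l`, given by its matrix coefficients. -/
noncomputable def harmRep (l : ℕ) {ε : ℝ} (hε : 0 < ε) : Rep Su2 (dilatedHarm l ε) :=
  (harmLadder l hε).rep suLower suRaise suWeight
    (fun x y => by
      simp only [suLower_apply, suWeight_apply, Su2.bracket_def, Su2.of_zero, Su2.of_one]
      push_cast
      linear_combination (x 1 * y 2 - x 2 * y 1 : ℂ) / 2 * Complex.I_sq)
    (fun x y => by
      simp only [suRaise_apply, suWeight_apply, Su2.bracket_def, Su2.of_zero, Su2.of_one]
      push_cast
      linear_combination (x 2 * y 1 - x 1 * y 2 : ℂ) / 2 * Complex.I_sq)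
    (fun x y i => by
      obtain ⟨m, hm⟩ := i
      rw [Set.mem_Icc] at hm
      have h1 := ladder_sq (l := l) (m := m) (by omega) (by omega)
      have h2 := ladder_sq (l := l) (m := m - 1) (by omega) (by omega)
      have h3 : ((ladder l m : ℂ) ^ 2 - (ladder l (m - 1) : ℂ) ^ 2) = -2 * m := by
        have : ladder l m ^ 2 - ladder l (m - 1) ^ 2 = -2 * m := by
          push_cast at h2
          linear_combination h1 - h2
        exact_mod_cast this
      simp only [suLower_apply, suRaise_apply, suWeight_apply, Su2.bracket_def, Su2.of_two,
        harmLadder, h3]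
      push_cast
      ring)

/-- The representation of `iso(2)` on `Ω_R`, given by its matrix coefficients. -/
noncomputable def besselRep {R : ℝ} (hR : 0 < R) : Rep Iso2 (besselSpace R) :=
  (besselLadder hR).rep isoLower isoRaise isoWeight
    (fun x y => by
      simp only [isoLower_apply, isoWeight_apply, Iso2.bracket_def, Iso2.of_zero, Iso2.of_one]
      push_cast
      linear_combination (x 2 * y 0 - x 0 * y 2 : ℂ) / 2 * Complex.I_sq)
    (fun x y => by
      simp only [isoRaise_apply, isoWeight_apply, Iso2.bracket_def, Iso2.of_zero, Iso2.of_one]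
      push_cast
      linear_combination (x 0 * y 2 - x 2 * y 0 : ℂ) / 2 * Complex.I_sq)
    (fun x y i => by
      simp [isoWeight_apply, Iso2.bracket_def, Iso2.of_two, besselLadder])

/-! ### The differential operators -/

/-- `f` has partial derivatives in the polar coordinates along `s × [0, 2π)`. -/
def HasPartials (s : Set ℝ) (p : ℝ × ℝ) (f : ℝ × ℝ → ℂ) : Prop :=
  DifferentiableWithinAt ℝ (fun x => f (x, p.2)) s p.1 ∧
    DifferentiableWithinAt ℝ (fun x => f (p.1, x)) (Set.Ico 0 (2 * Real.pi)) p.2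

/-- `D` is linear on the functions that have partial derivatives at `p`. -/
structure IsLinearAt (s : Set ℝ) (p : ℝ × ℝ) (D : (ℝ × ℝ → ℂ) → ℂ) : Prop where
  add : ∀ f g, HasPartials s p f → HasPartials s p g → D (f + g) = D f + D g
  smul : ∀ (c : ℂ) f, HasPartials s p f → D (c • f) = c * D f

theorem isLinearAt_dRadial (s : Set ℝ) (p : ℝ × ℝ) : IsLinearAt s p fun f => dRadial s f p where
  add _ _ hf hg := derivWithin_add hf.1 hg.1
  smul c _ hf := derivWithin_const_mul c hf.1

theorem isLinearAt_dAngle (s : Set ℝ) (p : ℝ × ℝ) : IsLinearAt s p fun f => dAngle f p where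
  add _ _ hf hg := derivWithin_add hf.2 hg.2
  smul c _ hf := derivWithin_const_mul c hf.2

theorem isLinearAt_suOperator (ε : ℝ) (Y : Su2) (p : ℝ × ℝ) :
    IsLinearAt (Set.Ico 0 (Real.pi / ε)) p fun f => suOperator ε Y f p where
  add f g hf hg := by
    simp only [suOperator, (isLinearAt_dRadial _ p).add f g hf hg,
      (isLinearAt_dAngle _ p).add f g hf hg]
    ring
  smul c f hf := by
    simp only [suOperator, (isLinearAt_dRadial _ p).smul c f hf,
      (isLinearAt_dAngle _ p).smul c f hf]
    ring

theorem isLinearAt_isoOperator (Y : Iso2) (p : ℝ × ℝ) :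
    IsLinearAt (Set.Ici 0) p fun f => isoOperator Y f p where
  add f g hf hg := by
    simp only [isoOperator, (isLinearAt_dRadial _ p).add f g hf hg,
      (isLinearAt_dAngle _ p).add f g hf hg]
    ring
  smul c f hf := by
    simp only [isoOperator, (isLinearAt_dRadial _ p).smul c f hf,
      (isLinearAt_dAngle _ p).smul c f hf]
    ring

/-- If an endomorphism agrees with `D` at the point `p` on a basis, then it agrees with `D` at `p`
on the whole space. -/
theorem IsLinearAt.eq_of_basis {s : Set ℝ} {p : ℝ × ℝ} {D : (ℝ × ℝ → ℂ) → ℂ}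
    (hD : IsLinearAt s p D) {V : Submodule ℂ (ℝ × ℝ → ℂ)} {ι : Type*} (b : Module.Basis ι ℂ V)
    (hb : ∀ i, HasPartials s p (b i)) (T : Module.End ℂ V)
    (hT : ∀ i, (T (b i) : ℝ × ℝ → ℂ) p = D (b i)) (f : V) :
    (T f : ℝ × ℝ → ℂ) p = D f := by
  have hf : f ∈ Submodule.span ℂ (Set.range b) := b.mem_span f
  have hcongr : ∀ c : ℂ, ∀ f : ℝ × ℝ → ℂ, HasPartials s p f → HasPartials s p (c • f) :=
    fun c f hf => ⟨hf.1.const_mul c, hf.2.const_mul c⟩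
  suffices h : HasPartials s p f ∧ (T f : ℝ × ℝ → ℂ) p = D f from h.2
  induction hf using Submodule.span_induction with
  | mem f h =>
    obtain ⟨i, rfl⟩ := h
    exact ⟨hb i, hT i⟩
  | zero =>
    have h0 : HasPartials s p 0 := ⟨differentiableWithinAt_const 0, differentiableWithinAt_const 0⟩
    refine ⟨h0, ?_⟩
    have := hD.smul 0 0 h0
    rw [zero_smul, zero_mul] at this
    rw [map_zero]
    exact this.symm
  | add f g _ _ hf hg =>
    refine ⟨⟨hf.1.1.add hg.1.1, hf.1.2.add hg.1.2⟩, ?_⟩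
    rw [map_add]
    exact (congrArg₂ (· + ·) hf.2 hg.2).trans (hD.add _ _ hf.1 hg.1).symm
  | smul c f _ hf =>
    refine ⟨hcongr c _ hf.1, ?_⟩
    rw [map_smul]
    exact (congrArg (c * ·) hf.2).trans (hD.smul c _ hf.1).symm

theorem sin_mul_ne_zero {ε : ℝ} (hε : 0 < ε) {p : ℝ × ℝ} (hp : p ∈ disc ε) (h0 : 0 < p.1) :
    Real.sin (ε * p.1) ≠ 0 :=
  (Real.sin_pos_of_pos_of_lt_pi (by positivity) ((lt_div_iff₀' hε).1 hp.1.2)).ne'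

theorem hasDerivAt_chi_radial (l : ℕ) (m : ℤ) {ε : ℝ} (hε : 0 < ε) {p : ℝ × ℝ} (hp : p ∈ disc ε)
    (h0 : 0 < p.1) :
    HasDerivAt (fun r => Complex.I ^ m * (legendreInt l m (ε * r) : ℂ))
      (Complex.I ^ m * (((m * Real.cot (ε * p.1) * legendreInt l m (ε * p.1) -
        ladder l m * legendreInt l (m + 1) (ε * p.1)) * ε : ℝ) : ℂ)) p.1 := by
  have h1 : HasDerivAt (fun r : ℝ => ε * r) ε p.1 := by
    simpa using (hasDerivAt_id p.1).const_mul ε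
  have h2 := (hasDerivAt_legendreInt l m (sin_mul_ne_zero hε hp h0)).comp p.1 h1
  exact h2.ofReal_comp.const_mul _

theorem hasDerivAt_besselMode_radial {R : ℝ} (hR : 0 < R) (m : ℤ) {r : ℝ} (h0 : 0 < r) :
    HasDerivAt (fun r => Complex.I ^ m * (besselJ m (R * r) : ℂ))
      (Complex.I ^ m * (((m / (R * r) * besselJ m (R * r) - besselJ (m + 1) (R * r)) * R : ℝ) : ℂ))
        r := by
  have h1 : HasDerivAt (fun r : ℝ => R * r) R r := by
    simpa using (hasDerivAt_id r).const_mul R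
  exact (((hasDerivAt_besselJ m (by positivity : R * r ≠ 0)).comp r h1).ofReal_comp).const_mul _

theorem hasPartials_chi (l : ℕ) (m : ℤ) {ε : ℝ} (hε : 0 < ε) {p : ℝ × ℝ} (hp : p ∈ disc ε)
    (h0 : 0 < p.1) : HasPartials (Set.Ico 0 (Real.pi / ε)) p (chi l ε m) := by
  rw [chi_eq_mode l hε]
  exact ⟨(hasDerivWithinAt_mode_radial hp
    (hasDerivAt_chi_radial l m hε hp h0)).differentiableWithinAt,
    (hasDerivWithinAt_mode_angle hp).differentiableWithinAt⟩

theorem hasPartials_besselMode {R : ℝ} (hR : 0 < R) (m : ℤ) {p : ℝ × ℝ} (hp : p ∈ plane)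
    (h0 : 0 < p.1) : HasPartials (Set.Ici 0) p (besselMode R m) := by
  rw [besselMode_eq_mode]
  exact ⟨(hasDerivWithinAt_mode_radial hp
    (hasDerivAt_besselMode_radial hR m h0)).differentiableWithinAt,
    (hasDerivWithinAt_mode_angle hp).differentiableWithinAt⟩

/-- Multiplication by `sin` and `cos` shifts the angular frequency by one. -/
theorem sin_cos_eq_exp (m : ℤ) (x : ℝ) :
    ((Real.sin x : ℂ) =
      Complex.I / 2 * (Complex.exp (-(Complex.I * x)) - Complex.exp (Complex.I * x)))
    ∧ ((Real.cos x : ℂ) = (Complex.exp (Complex.I * x) + Complex.exp (-(Complex.I * x))) / 2)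
    ∧ Complex.exp (Complex.I * (m + 1 : ℤ) * x) =
      Complex.exp (Complex.I * m * x) * Complex.exp (Complex.I * x)
    ∧ Complex.exp (Complex.I * (m - 1 : ℤ) * x) =
      Complex.exp (Complex.I * m * x) * Complex.exp (-(Complex.I * x)) := by
  refine ⟨?_, ?_, ?_, ?_⟩
  · rw [Complex.ofReal_sin, Complex.sin]
    ring_nf
  · rw [Complex.ofReal_cos, Complex.cos]
    ring_nf
  · rw [← Complex.exp_add]
    push_cast
    ring_nf
  · rw [← Complex.exp_add]
    push_cast
    ring_nf

theorem suOperator_chi (l : ℕ) (m : ℤ) {ε : ℝ} (hε : 0 < ε) (Y : Su2) {p : ℝ × ℝ}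
    (hp : p ∈ disc ε) (h0 : 0 < p.1) :
    suOperator ε Y (chi l ε m) p = suLower Y * ladder l (m - 1) * chi l ε (m - 1) p +
      suRaise Y * ladder l m * chi l ε (m + 1) p + suWeight Y * m * chi l ε m p := by
  have hr := (hasDerivWithinAt_mode_radial (k := -m) hp
    (hasDerivAt_chi_radial l m hε hp h0)).derivWithin (uniqueDiffOn_Ico 0 _ _ hp.1)
  have ha := (hasDerivWithinAt_mode_angle (k := -m)
    (A := fun r => Complex.I ^ m * (legendreInt l m (ε * r) : ℂ)) hp).derivWithin
    (uniqueDiffOn_Ico 0 _ _ hp.2)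
  have h3 := congrArg (Complex.ofReal) (legendreInt_three_term l m (sin_mul_ne_zero hε hp h0))
  simp only [suOperator, dRadial, dAngle, chi_eq_mode l hε, hr, ha,
    mode_apply (s := Set.Ico 0 (Real.pi / ε)) hp]
  obtain ⟨e1, e2, e3, e4⟩ := sin_cos_eq_exp (-m) p.2
  rw [show -(m - 1) = -m + 1 by ring, show -(m + 1) = -m - 1 by ring, e1, e2, e3, e4,
    zpow_add_one₀ Complex.I_ne_zero, zpow_sub_one₀ Complex.I_ne_zero, Complex.inv_I,
    suLower_apply, suRaise_apply, suWeight_apply]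
  generalize Complex.exp (Complex.I * p.2) = e
  generalize Complex.exp (-(Complex.I * p.2)) = e'
  generalize Complex.exp _ = E
  generalize Complex.I ^ m = z
  push_cast at h3 ⊢
  generalize Complex.cot _ = c at h3 ⊢
  generalize (legendreInt l m (ε * p.1) : ℂ) = g at h3 ⊢
  generalize (legendreInt l (m + 1) (ε * p.1) : ℂ) = gp at h3 ⊢
  generalize (legendreInt l (m - 1) (ε * p.1) : ℂ) = gm at h3 ⊢
  have hε' : (ε : ℂ) ≠ 0 := by exact_mod_cast hε.ne'
  field_simp
  linear_combination -(z * E * e * (Complex.I * Y 0 + Y 1)) * h3 +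
    z * E * Y 1 * (-((e' - e) * m * c * g) - e * ladder l (m - 1) * gm + e' * ladder l m * gp) *
      Complex.I_sq

theorem isoOperator_besselMode {R : ℝ} (hR : 0 < R) (m : ℤ) (Y : Iso2) {p : ℝ × ℝ}
    (hp : p ∈ plane) (h0 : 0 < p.1) :
    isoOperator Y (besselMode R m) p = isoLower Y * R * besselMode R (m - 1) p +
      isoRaise Y * R * besselMode R (m + 1) p + isoWeight Y * m * besselMode R m p := by
  have hr := (hasDerivWithinAt_mode_radial (k := m) hp
    (hasDerivAt_besselMode_radial hR m h0)).derivWithin (uniqueDiffOn_Ici 0 _ hp.1)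
  have ha := (hasDerivWithinAt_mode_angle (k := m)
    (A := fun r => Complex.I ^ m * (besselJ m (R * r) : ℂ)) hp).derivWithin
    (uniqueDiffOn_Ico 0 _ _ hp.2)
  have h3 := congrArg (Complex.ofReal)
    (besselJ_three_term m (mul_pos hR h0).ne')
  simp only [isoOperator, dRadial, dAngle, besselMode_eq_mode, hr, ha,
    mode_apply (s := Set.Ici 0) hp]
  obtain ⟨e1, e2, e3, e4⟩ := sin_cos_eq_exp m p.2
  rw [e1, e2, e3, e4,
    zpow_add_one₀ Complex.I_ne_zero, zpow_sub_one₀ Complex.I_ne_zero, Complex.inv_I,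
    isoLower_apply, isoRaise_apply, isoWeight_apply]
  generalize Complex.exp (Complex.I * p.2) = e
  generalize Complex.exp (-(Complex.I * p.2)) = e'
  generalize Complex.exp _ = E
  generalize Complex.I ^ m = z
  push_cast at h3 ⊢
  generalize (besselJ m (R * p.1) : ℂ) = g at h3 ⊢
  generalize (besselJ (m + 1) (R * p.1) : ℂ) = gp at h3 ⊢
  generalize (besselJ (m - 1) (R * p.1) : ℂ) = gm at h3 ⊢
  have hR' : (R : ℂ) ≠ 0 := by exact_mod_cast hR.ne'
  have hr' : (p.1 : ℂ) ≠ 0 := by exact_mod_cast h0.ne'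
  field_simp at h3 ⊢
  linear_combination -(z * E * e' * (Y 0 + Complex.I * Y 1)) * h3 +
    z * E * Y 0 * (m * g * (e' - e) - p.1 * R * (gm * e' - gp * e)) * Complex.I_sq

theorem isDilatedRep_harmRep (l : ℕ) {ε : ℝ} (hε : 0 < ε) :
    IsDilatedRep l ε (harmRep l hε) := by
  intro Y f p hp h0
  refine (isLinearAt_suOperator ε Y p).eq_of_basis (harmBasis l hε) (fun i => ?_)
    (harmRep l hε Y) (fun i => ?_) f
  · rw [harmBasis_apply]
    exact hasPartials_chi l i hε hp h0
  · rw [harmBasis_apply]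
    exact (congrFun (congrArg Subtype.val ((harmLadder l hε).op_vec _ _ _ i)) p).trans
      (suOperator_chi l i hε Y hp h0).symm

theorem isPlaneRep_besselRep {R : ℝ} (hR : 0 < R) : IsPlaneRep R (besselRep hR) := by
  intro Y f p hp h0
  refine (isLinearAt_isoOperator Y p).eq_of_basis (besselBasis hR) (fun i => ?_)
    (besselRep hR Y) (fun i => ?_) f
  · rw [besselBasis_apply]
    exact hasPartials_besselMode hR i hp h0
  · rw [besselBasis_apply]
    exact (congrFun (congrArg Subtype.val ((besselLadder hR).op_vec _ _ _ i)) p).trans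
      (isoOperator_besselMode hR i Y hp h0).symm

theorem IsDilatedRep.apply_chiVec {l : ℕ} {ε : ℝ} (hε : 0 < ε) {ρ : Rep Su2 (dilatedHarm l ε)}
    (hρ : IsDilatedRep l ε ρ) (Y : Su2) (m : ℤ) :
    ρ Y (chiVec l hε m) = (suLower Y * ladder l (m - 1)) • chiVec l hε (m - 1) +
      (suRaise Y * ladder l m) • chiVec l hε (m + 1) + (suWeight Y * m) • chiVec l hε m :=
  dilatedHarm_ext hε fun _ hp h0 =>
    (hρ Y _ _ hp h0).trans (suOperator_chi l m hε Y hp h0)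

theorem IsPlaneRep.apply_besselVec {R : ℝ} (hR : 0 < R) {η : Rep Iso2 (besselSpace R)}
    (hη : IsPlaneRep R η) (Y : Iso2) (m : ℤ) :
    η Y (besselVec R m) = (isoLower Y * R) • besselVec R (m - 1) +
      (isoRaise Y * R) • besselVec R (m + 1) + (isoWeight Y * m) • besselVec R m :=
  besselSpace_ext fun _ hp h0 =>
    (hη Y _ _ hp h0).trans (isoOperator_besselMode hR m Y hp h0)

/-! ### Hermitian forms determined by a basis -/

/-- `B` is linear in the first variable and conjugate symmetric. -/
structure IsHermitianForm {V : Type*} [AddCommGroup V] [Module ℂ V] (B : V → V → ℂ) : Prop where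
  add_left : ∀ f g h, B (f + g) h = B f h + B g h
  smul_left : ∀ (c : ℂ) f g, B (c • f) g = c * B f g
  conj_symm : ∀ f g, B g f = (starRingEnd ℂ) (B f g)

namespace IsHermitianForm

variable {V : Type*} [AddCommGroup V] [Module ℂ V] {B B' : V → V → ℂ}

theorem of_isInnerProduct (h : IsInnerProduct B) : IsHermitianForm B :=
  ⟨h.add_left, h.smul_left, h.conj_symm⟩

theorem comp (hB : IsHermitianForm B) {W : Type*} [AddCommGroup W] [Module ℂ W] (f : W →ₗ[ℂ] V) :
    IsHermitianForm fun x y => B (f x) (f y) where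
  add_left x y z := by rw [map_add, hB.add_left]
  smul_left c x y := by rw [map_smul, hB.smul_left]
  conj_symm x y := hB.conj_symm _ _

theorem ext_left (hB : IsHermitianForm B) (hB' : IsHermitianForm B') {ι : Type*}
    (b : Module.Basis ι ℂ V) {g : V} (h : ∀ i, B (b i) g = B' (b i) g) (f : V) :
    B f g = B' f g := by
  let L : V →ₗ[ℂ] ℂ := ⟨⟨fun f => B f g, fun x y => hB.add_left x y g⟩,
    fun c x => hB.smul_left c x g⟩
  let L' : V →ₗ[ℂ] ℂ := ⟨⟨fun f => B' f g, fun x y => hB'.add_left x y g⟩,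
    fun c x => hB'.smul_left c x g⟩
  exact congrArg (· f) (b.ext (f₁ := L) (f₂ := L') h)

theorem ext_basis (hB : IsHermitianForm B) (hB' : IsHermitianForm B') {ι : Type*}
    (b : Module.Basis ι ℂ V) (h : ∀ i j, B (b i) (b j) = B' (b i) (b j)) (f g : V) :
    B f g = B' f g := by
  refine hB.ext_left hB' b (fun i => ?_) f
  rw [hB.conj_symm, hB'.conj_symm]
  congr 1
  exact hB.ext_left hB' b (fun j => h j i) g

end IsHermitianForm

/-- The form for which the basis `b` is orthogonal and every basis vector has squared norm `c`. -/
noncomputable def basisForm {V ι : Type*} [AddCommGroup V] [Module ℂ V] (c : ℝ)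
    (b : Module.Basis ι ℂ V) (f g : V) : ℂ :=
  c * (b.repr f).sum fun i a => a * (starRingEnd ℂ) (b.repr g i)

theorem basisForm_basis {V ι : Type*} [DecidableEq ι] [AddCommGroup V] [Module ℂ V] (c : ℝ)
    (b : Module.Basis ι ℂ V) (i j : ι) :
    basisForm c b (b i) (b j) = if i = j then (c : ℂ) else 0 := by
  rw [basisForm, b.repr_self, b.repr_self, Finsupp.sum_single_index (by simp),
    Finsupp.single_apply]
  by_cases h : i = j
  · simp [h]
  · simp [h, Ne.symm h]

theorem isInnerProduct_basisForm {V ι : Type*} [AddCommGroup V] [Module ℂ V] {c : ℝ} (hc : 0 < c)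
    (b : Module.Basis ι ℂ V) : IsInnerProduct (basisForm c b) := by
  classical
  have hself : ∀ f : V, basisForm c b f f =
      ((c * (b.repr f).sum fun _ a => ‖a‖ ^ 2 : ℝ) : ℂ) := by
    intro f
    rw [basisForm, Finsupp.sum, Finsupp.sum]
    push_cast
    simp only [Complex.mul_conj']
  have hnn : ∀ f : V, ∀ i ∈ (b.repr f).support, 0 ≤ ‖b.repr f i‖ ^ 2 := fun _ _ _ => by positivity
  refine ⟨fun f g h => ?_, fun a f g => ?_, fun f g => ?_, fun f => ?_, fun f hf => ?_⟩
  · rw [basisForm, map_add, Finsupp.sum_add_index (by simp) (by intros; ring), mul_add]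
    rfl
  · rw [basisForm, map_smul, Finsupp.sum_smul_index (by simp), basisForm, Finsupp.mul_sum,
      Finsupp.mul_sum, Finsupp.mul_sum]
    exact Finsupp.sum_congr fun i _ => by ring
  · have key : ∀ f g : V, basisForm c b f g = c * ∑ i ∈ (b.repr f).support ∪ (b.repr g).support,
        b.repr f i * (starRingEnd ℂ) (b.repr g i) := by
      intro f g
      rw [basisForm, Finsupp.sum_of_support_subset _ Finset.subset_union_left _ (by simp)]
    rw [key, key, Finset.union_comm, map_mul, map_sum, Complex.conj_ofReal]
    congr 1
    refine Finset.sum_congr rfl fun i _ => ?_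
    rw [map_mul, Complex.conj_conj, mul_comm]
  · rw [hself, Complex.ofReal_re]
    exact mul_nonneg hc.le (Finset.sum_nonneg (hnn f))
  · rw [hself, Complex.ofReal_eq_zero, mul_eq_zero, or_iff_right hc.ne', Finsupp.sum,
      Finset.sum_eq_zero_iff_of_nonneg (hnn f)] at hf
    apply b.repr.map_eq_zero_iff.1
    ext i
    by_contra hi
    have := hf i (Finsupp.mem_support_iff.2 hi)
    rw [sq_eq_zero_iff, norm_eq_zero] at this
    exact hi this

/-! ### Orthogonality of the spherical harmonics -/

theorem measurableSet_disc (ε : ℝ) : MeasurableSet (disc ε) :=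
  measurableSet_Ico.prod measurableSet_Ico

theorem disc_subset_isCompact (ε : ℝ) :
    disc ε ⊆ Set.Icc 0 (Real.pi / ε) ×ˢ Set.Icc 0 (2 * Real.pi) :=
  Set.prod_mono Set.Ico_subset_Icc_self Set.Ico_subset_Icc_self

theorem isFiniteMeasure_dilatedMeasure (l : ℕ) (ε : ℝ) :
    IsFiniteMeasure ((dilatedMeasure l ε).restrict (disc ε)) := by
  rw [dilatedMeasure, restrict_withDensity (measurableSet_disc ε)]
  refine isFiniteMeasure_withDensity_ofReal (Integrable.hasFiniteIntegral ?_)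
  have hc : Continuous fun p : ℝ × ℝ => (2 * l + 1) * Real.sin (ε * p.1) * ε := by fun_prop
  exact (hc.continuousOn.integrableOn_compact
    (isCompact_Icc.prod isCompact_Icc)).mono_set (disc_subset_isCompact ε)

theorem memLp_chi (l : ℕ) {ε : ℝ} (hε : 0 < ε) (m : ℤ) :
    MemLp (chi l ε m) 2 ((dilatedMeasure l ε).restrict (disc ε)) := by
  have := isFiniteMeasure_dilatedMeasure l ε
  have hg := continuous_legendreInt l m
  have hc : Continuous fun p : ℝ × ℝ => Complex.I ^ m * (legendreInt l m (ε * p.1) : ℂ) *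
      Complex.exp (Complex.I * (-m : ℤ) * p.2) := by fun_prop
  obtain ⟨C, hC⟩ := (isCompact_Icc.prod isCompact_Icc).exists_bound_of_continuousOn
    (s := Set.Icc 0 (Real.pi / ε) ×ˢ Set.Icc 0 (2 * Real.pi)) hc.continuousOn
  rw [chi_eq_mode l hε]
  refine MemLp.of_bound ?_ C ?_
  · exact (hc.measurable.indicator (measurableSet_disc ε)).aestronglyMeasurable
  · filter_upwards [ae_restrict_mem (measurableSet_disc ε)] with p hp
    rw [mode_apply (s := Set.Ico 0 (Real.pi / ε)) hp]
    exact hC p (disc_subset_isCompact ε hp)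

theorem memLp_dilatedHarm (l : ℕ) {ε : ℝ} (hε : 0 < ε) {f : ℝ × ℝ → ℂ}
    (hf : f ∈ dilatedHarm l ε) : MemLp f 2 ((dilatedMeasure l ε).restrict (disc ε)) := by
  rw [dilatedHarm_eq_span] at hf
  induction hf using Submodule.span_induction with
  | mem f h =>
    obtain ⟨m, rfl⟩ := h
    exact memLp_chi l hε m
  | zero => exact MemLp.zero
  | add f g _ _ hf hg => exact hf.add hg
  | smul c f _ hf => exact hf.const_smul c

theorem isHermitianForm_l2Inner {Ω : Type*} [MeasurableSpace Ω] {X : Set Ω} {μ : Measure Ω}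
    {V : Submodule ℂ (Ω → ℂ)} (hV : ∀ f ∈ V, MemLp f 2 (μ.restrict X)) :
    IsHermitianForm (l2Inner X μ : V → V → ℂ) := by
  have hint : ∀ f g : V, Integrable (fun x => (f : Ω → ℂ) x * (starRingEnd ℂ) ((g : Ω → ℂ) x))
      (μ.restrict X) := fun f g => (hV f f.2).integrable_mul (hV g g.2).star
  refine ⟨fun f g h => ?_, fun c f g => ?_, fun f g => ?_⟩
  · rw [l2Inner, l2Inner, l2Inner, ← integral_add (hint f h) (hint g h)]
    simp only [Submodule.coe_add, Pi.add_apply, add_mul]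
  · rw [l2Inner, l2Inner, ← integral_const_mul]
    simp only [Submodule.coe_smul, Pi.smul_apply, smul_eq_mul, mul_assoc]
  · rw [l2Inner, l2Inner, ← integral_conj]
    simp only [map_mul, Complex.conj_conj, mul_comm]

theorem l2Inner_chiVec (l : ℕ) {ε : ℝ} (hε : 0 < ε) {m s : ℤ} (hm : m.natAbs ≤ l) :
    l2Inner (disc ε) (dilatedMeasure l ε) (chiVec l hε m) (chiVec l hε s) =
      if m = s then ((4 * Real.pi : ℝ) : ℂ) else 0 := by
  have hmeas : Measurable fun p : ℝ × ℝ =>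
      ENNReal.ofReal ((2 * l + 1) * Real.sin (ε * p.1) * ε) := by fun_prop
  rw [l2Inner, dilatedMeasure, restrict_withDensity (measurableSet_disc ε),
    integral_withDensity_eq_integral_toReal_smul hmeas (by simp)]
  have hcongr : ∀ p ∈ disc ε, (ENNReal.ofReal ((2 * l + 1) * Real.sin (ε * p.1) * ε)).toReal •
      ((chiVec l hε m : ℝ × ℝ → ℂ) p * (starRingEnd ℂ) ((chiVec l hε s : ℝ × ℝ → ℂ) p)) =
      (Complex.I ^ m * (starRingEnd ℂ) (Complex.I ^ s) *
        (((2 * l + 1) * Real.sin (ε * p.1) * ε * legendreInt l m (ε * p.1) *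
          legendreInt l s (ε * p.1) : ℝ) : ℂ)) * Complex.exp (Complex.I * (s - m : ℤ) * p.2) := by
    intro p hp
    have hsin : 0 ≤ Real.sin (ε * p.1) := Real.sin_nonneg_of_nonneg_of_le_pi
      (mul_nonneg hε.le hp.1.1) ((lt_div_iff₀' hε).1 hp.1.2).le
    rw [ENNReal.toReal_ofReal (by positivity), chiVec, chiVec]
    simp only [chi_eq_mode l hε, mode_apply (s := Set.Ico 0 (Real.pi / ε)) hp]
    rw [Complex.real_smul, map_mul, map_mul, ← Complex.exp_conj, Complex.conj_ofReal,
      map_mul, map_mul, Complex.conj_I, Complex.conj_ofReal, map_intCast,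
      show Complex.I * ((s - m : ℤ) : ℂ) * p.2 =
        Complex.I * ((-m : ℤ) : ℂ) * p.2 + -Complex.I * ((-s : ℤ) : ℂ) * p.2 by push_cast; ring,
      Complex.exp_add]
    push_cast
    ring
  rw [setIntegral_congr_fun (measurableSet_disc ε) hcongr, disc, Measure.volume_eq_prod,
    setIntegral_prod_mul (fun r : ℝ => Complex.I ^ m * (starRingEnd ℂ) (Complex.I ^ s) *
        (((2 * l + 1) * Real.sin (ε * r) * ε * legendreInt l m (ε * r) *
          legendreInt l s (ε * r) : ℝ) : ℂ))
      (fun x : ℝ => Complex.exp (Complex.I * (s - m : ℤ) * x)),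
    integral_Ico_eq_integral_Ioc, integral_Ico_eq_integral_Ioc,
    ← intervalIntegral.integral_of_le (by positivity),
    ← intervalIntegral.integral_of_le (by positivity), integral_exp_int]
  rcases eq_or_ne m s with rfl | h
  swap
  · rw [if_neg (by rw [sub_eq_zero]; exact h.symm), if_neg h, mul_zero]
  rw [if_pos (sub_self m), if_pos rfl, intervalIntegral.integral_const_mul,
    intervalIntegral.integral_ofReal, Complex.mul_conj', norm_zpow, Complex.norm_I, one_zpow]
  have hsubst : ∫ r in (0 : ℝ)..Real.pi / ε, (2 * l + 1) * Real.sin (ε * r) * ε *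
      legendreInt l m (ε * r) * legendreInt l m (ε * r) = 2 := by
    have h1 := intervalIntegral.integral_comp_mul_left (a := 0) (b := Real.pi / ε)
      (fun θ => legendreInt l m θ ^ 2 * Real.sin θ) hε.ne'
    rw [mul_zero, mul_div_cancel₀ _ hε.ne', integral_legendreInt_sq hm] at h1
    calc _ = ∫ r in (0 : ℝ)..Real.pi / ε, ((2 * l + 1) * ε) *
          (legendreInt l m (ε * r) ^ 2 * Real.sin (ε * r)) := by
          congr 1; funext r; ring
      _ = 2 := by
          rw [intervalIntegral.integral_const_mul, h1, smul_eq_mul]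
          field_simp
  rw [hsubst]
  push_cast
  ring

theorem l2Inner_eq_basisForm (l : ℕ) {ε : ℝ} (hε : 0 < ε) :
    (l2Inner (disc ε) (dilatedMeasure l ε) : dilatedHarm l ε → dilatedHarm l ε → ℂ) =
      basisForm (4 * Real.pi) (harmBasis l hε) := by
  funext f g
  refine (isHermitianForm_l2Inner fun f hf => memLp_dilatedHarm l hε hf).ext_basis
    (.of_isInnerProduct (isInnerProduct_basisForm (by positivity) _)) (harmBasis l hε)
    (fun i j => ?_) f g
  rw [basisForm_basis, harmBasis_apply, harmBasis_apply,
    l2Inner_chiVec l hε (mem_Icc_iff_natAbs.1 i.2)]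
  simp only [Subtype.ext_iff]

theorem IsBesselInner.eq_basisForm {R : ℝ} (hR : 0 < R) {ip : besselSpace R → besselSpace R → ℂ}
    (h : IsBesselInner R ip) : ip = basisForm (4 * Real.pi) (besselBasis hR) := by
  funext f g
  refine (IsHermitianForm.of_isInnerProduct h.1).ext_basis
    (.of_isInnerProduct (isInnerProduct_basisForm (by positivity) _)) (besselBasis hR)
    (fun i j => ?_) f g
  rw [basisForm_basis, besselBasis_apply, besselBasis_apply, h.2]

theorem isBesselInner_basisForm {R : ℝ} (hR : 0 < R) :
    IsBesselInner R (basisForm (4 * Real.pi) (besselBasis hR)) := by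
  refine ⟨isInnerProduct_basisForm (by positivity) _, fun m s => ?_⟩
  rw [← besselBasis_apply hR, ← besselBasis_apply hR, basisForm_basis]

/-- A linear map that sends basis vectors to distinct basis vectors is isometric. -/
theorem basisForm_map {V W ι κ : Type*} [AddCommGroup V] [Module ℂ V] [AddCommGroup W] [Module ℂ W]
    {c : ℝ} (hc : 0 < c) (b : Module.Basis ι ℂ V) (b' : Module.Basis κ ℂ W) {e : ι → κ}
    (he : Function.Injective e) (f : V →ₗ[ℂ] W) (hf : ∀ i, f (b i) = b' (e i)) (x y : V) :
    basisForm c b' (f x) (f y) = basisForm c b x y := by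
  classical
  refine ((IsHermitianForm.of_isInnerProduct (isInnerProduct_basisForm hc b')).comp f).ext_basis
    (.of_isInnerProduct (isInnerProduct_basisForm hc b)) b (fun i j => ?_) x y
  simp only [hf, basisForm_basis, he.eq_iff]

/-! ### The contraction of the Lie algebras and of the domains -/

theorem eps_pos {R : ℝ} (hR : 0 < R) (l : ℕ+) : 0 < eps R l :=
  div_pos hR (Nat.cast_pos.2 l.pos)

theorem isLieContraction_contractionMap {R : ℝ} (hR : 0 < R) :
    IsLieContraction (fun l : ℕ+ => contractionMap (eps R l) (eps_ne_zero hR l)) psi := by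
  intro X Y
  have he : Tendsto (fun l : ℕ+ => eps R l) atTop (𝓝 0) :=
    (tendsto_const_div_atTop_nhds_zero_nat R).comp tendsto_PNat_val_atTop_atTop
  have h : ∀ l : ℕ+, (contractionMap (eps R l) (eps_ne_zero hR l)).symm
      ⁅contractionMap (eps R l) (eps_ne_zero hR l) X,
        contractionMap (eps R l) (eps_ne_zero hR l) Y⁆ =
      Su2.of (X 1 * Y 2 - X 2 * Y 1) (X 2 * Y 0 - X 0 * Y 2)
        (eps R l ^ 2 * (X 0 * Y 1 - X 1 * Y 0)) := by
    intro l
    have := eps_ne_zero hR l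
    apply Su2.ext3 <;> simp [contractionMap, Su2.bracket_def] <;> field_simp
  have h0 : psi.symm ⁅psi X, psi Y⁆ =
      Su2.of (X 1 * Y 2 - X 2 * Y 1) (X 2 * Y 0 - X 0 * Y 2) 0 := by
    apply Su2.ext3
    · simp [psi, Iso2.bracket_def]
    · simp [psi, Iso2.bracket_def]
      ring
    · simp [psi, Iso2.bracket_def]
  simp only [h, h0]
  refine tendsto_pi_nhds.2 fun i => ?_
  fin_cases i
  · exact tendsto_const_nhds
  · exact tendsto_const_nhds
  · have := (he.pow 2).mul_const (X 0 * Y 1 - X 1 * Y 0)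
    rwa [zero_pow two_ne_zero, zero_mul] at this

theorem disc_eps_mono {R : ℝ} (hR : 0 < R) {j l : ℕ+} (h : j ≤ l) :
    disc (eps R j) ⊆ disc (eps R l) := by
  refine Set.prod_mono (Set.Ico_subset_Ico_right ?_) subset_rfl
  have := eps_pos hR l
  have : eps R l ≤ eps R j := by
    have hj : (0 : ℝ) < (j : ℕ) := Nat.cast_pos.2 j.pos
    unfold eps
    gcongr
    exact_mod_cast h
  have := Real.pi_pos
  gcongr

theorem plane_eq_iUnion {R : ℝ} (hR : 0 < R) : plane = ⋃ l : ℕ+, disc (eps R l) := by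
  refine Set.Subset.antisymm (fun p hp => ?_) (Set.iUnion_subset fun l p hp => ⟨hp.1.1, hp.2⟩)
  obtain ⟨n, hn⟩ := exists_nat_gt (p.1 * R / Real.pi)
  refine Set.mem_iUnion.2 ⟨n.succPNat, ⟨hp.1, ?_⟩, hp.2⟩
  rw [lt_div_iff₀ (eps_pos hR _), eps, Nat.succPNat_coe, Nat.succ_eq_add_one, ← mul_div_assoc,
    div_lt_iff₀ (by positivity), ← div_lt_iff₀' Real.pi_pos]
  push_cast
  linarith

theorem eventually_mem_disc {R : ℝ} (hR : 0 < R) {p : ℝ × ℝ} (hp : p ∈ plane) :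
    ∀ᶠ l : ℕ+ in atTop, p ∈ disc (eps R l) := by
  rw [plane_eq_iUnion hR] at hp
  obtain ⟨j, hj⟩ := Set.mem_iUnion.1 hp
  filter_upwards [eventually_ge_atTop j] with l hl using disc_eps_mono hR hl hj

/-! ### The limit map -/

theorem besselMode_neg_apply (R : ℝ) (m : ℤ) {p : ℝ × ℝ} (hp : p ∈ plane) :
    besselMode R (-m) p = Complex.I ^ m * (besselJ m (R * p.1) : ℂ) *
      Complex.exp (-(Complex.I * m * p.2)) := by
  have hI : Complex.I ^ (-m) * (-1) ^ m.natAbs = Complex.I ^ m := by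
    have h1 : (-1 : ℂ) ^ m.natAbs = Complex.I ^ (2 * m) := by
      rw [zpow_mul, zpow_ofNat, Complex.I_sq]
      obtain ⟨n, rfl | rfl⟩ := m.eq_nat_or_neg
      · simp
      · simp [← inv_pow]
    rw [h1, ← zpow_add₀ Complex.I_ne_zero]
    congr 1
    ring
  rw [besselMode_eq_mode, mode_apply (s := Set.Ici 0) hp, besselJ_neg]
  push_cast
  rw [← mul_assoc, hI]
  ring_nf

theorem tendsto_chi {R : ℝ} (hR : 0 < R) (m : ℤ) {p : ℝ × ℝ} (hp : p ∈ plane) :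
    Tendsto (fun l : ℕ+ => chi l (eps R l) m p) atTop (𝓝 (besselMode R (-m) p)) := by
  rw [besselMode_neg_apply R m hp]
  refine (tendsto_sphericalY R m p.1 p.2).congr' ?_
  filter_upwards [eventually_mem_disc hR hp] with l hl
  change _ = (disc 1).indicator (fun p : ℝ × ℝ => sphericalY l m p.1 p.2) (eps R l * p.1, p.2)
  rw [Set.indicator_of_mem ((mem_disc_one_iff (eps_pos hR l) p).2 hl)]

/-- The linear map `V_l → Ω_R` with `χ_l^m ↦ B_{-m}^R`, which turns out to be the pointwise limit
of the embeddings. -/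
noncomputable def limitMap {R : ℝ} (hR : 0 < R) (l : ℕ+) :
    dilatedHarm l (eps R l) →ₗ[ℂ] besselSpace R :=
  (harmBasis l (eps_pos hR l)).constr ℂ fun m => besselVec R (-m)

theorem limitMap_chiVec {R : ℝ} (hR : 0 < R) (l : ℕ+) {m : ℤ} (hm : m.natAbs ≤ l) :
    limitMap hR l (chiVec l (eps_pos hR l) m) = besselVec R (-m) := by
  rw [← harmBasis_apply l (eps_pos hR l) ⟨m, mem_Icc_iff_natAbs.2 hm⟩, limitMap,
    Module.Basis.constr_basis]

/-- The coefficient is needed for `m = -l`, where `χ_l^{m-1}` is zero but `B_{-m+1}^R` is not. -/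
theorem limitMap_lower {R : ℝ} (hR : 0 < R) (l : ℕ+) {m : ℤ} (hm : m.natAbs ≤ l) :
    (ladder l (m - 1) : ℂ) • limitMap hR l (chiVec l (eps_pos hR l) (m - 1)) =
      (ladder l (m - 1) : ℂ) • besselVec R (-m + 1) := by
  rcases eq_or_ne m (-((l : ℕ) : ℤ)) with rfl | h
  · simp [ladder_bot]
  · rw [limitMap_chiVec hR l (by omega), neg_sub, sub_eq_neg_add 1 m]

/-- The coefficient is needed for `m = l`, where `χ_l^{m+1}` is zero but `B_{-m-1}^R` is not. -/
theorem limitMap_raise {R : ℝ} (hR : 0 < R) (l : ℕ+) {m : ℤ} (hm : m.natAbs ≤ l) :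
    (ladder l m : ℂ) • limitMap hR l (chiVec l (eps_pos hR l) (m + 1)) =
      (ladder l m : ℂ) • besselVec R (-m - 1) := by
  rcases eq_or_ne m ((l : ℕ) : ℤ) with rfl | h
  · simp [ladder_self]
  · rw [limitMap_chiVec hR l (by omega), neg_add']

theorem tendsto_eps_mul_ladder {R : ℝ} (m : ℤ) :
    Tendsto (fun l : ℕ+ => eps R l * ladder l m) atTop (𝓝 R) := by
  have h0 := tendsto_inv_atTop_nhds_zero_nat (𝕜 := ℝ)
  have h1 : Tendsto (fun l : ℕ => (1 - m * (l : ℝ)⁻¹) * (1 + (m + 1) * (l : ℝ)⁻¹)) atTop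
      (𝓝 ((1 - m * 0) * (1 + (m + 1) * 0))) :=
    (tendsto_const_nhds.sub (h0.const_mul _)).mul (tendsto_const_nhds.add (h0.const_mul _))
  have h2 := (((Real.continuous_sqrt.tendsto _).comp h1).const_mul R).comp
    tendsto_PNat_val_atTop_atTop
  rw [mul_zero, mul_zero, sub_zero, add_zero, mul_one, Real.sqrt_one, mul_one] at h2
  refine h2.congr fun l => ?_
  have hl : (0 : ℝ) < (l : ℕ) := Nat.cast_pos.2 l.pos
  simp only [Function.comp, eps, ladder]
  rw [show ((l : ℕ) - m : ℝ) * ((l : ℕ) + m + 1) = ((l : ℕ) : ℝ) ^ 2 *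
    ((1 - m * (((l : ℕ) : ℝ))⁻¹) * (1 + (m + 1) * (((l : ℕ) : ℝ))⁻¹)) by field_simp; ring,
    Real.sqrt_mul (sq_nonneg _), Real.sqrt_sq hl.le]
  field_simp

/-! ### Null sequences -/

/-- Sequences that tend to zero pointwise and in the norm of `ip`. -/
structure IsNull {R : ℝ} {ι : Type*} (F : Filter ι) (ip : besselSpace R → besselSpace R → ℂ)
    (u : ι → besselSpace R) : Prop where
  pointwise : ∀ x, Tendsto (fun n => (u n : ℝ × ℝ → ℂ) x) F (𝓝 0)
  norm : Tendsto (fun n => (ip (u n) (u n)).re) F (𝓝 0)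

section IsNull

variable {R : ℝ} {ι : Type*} {F : Filter ι} {ip : besselSpace R → besselSpace R → ℂ}
  {u v : ι → besselSpace R}

theorem IsNull.smul_vec (hip : IsInnerProduct ip) {c : ι → ℂ} (hc : Tendsto c F (𝓝 0))
    (w : besselSpace R) : IsNull F ip fun n => c n • w := by
  have hs : ∀ a : ℂ, ip (a • w) (a • w) = a * (starRingEnd ℂ) a * ip w w := by
    intro a
    rw [hip.smul_left, hip.conj_symm, hip.smul_left, map_mul, ← hip.conj_symm, mul_assoc]
  refine ⟨fun x => ?_, ?_⟩
  · have := hc.mul_const ((w : ℝ × ℝ → ℂ) x)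
    rwa [zero_mul] at this
  · simp only [hs]
    have h1 := (hc.mul ((Complex.continuous_conj.tendsto _).comp hc)).mul_const (ip w w)
    have h2 := (Complex.continuous_re.tendsto _).comp h1
    rwa [zero_mul, zero_mul, Complex.zero_re] at h2

/-- By the parallelogram law the squared norm of a sum is at most twice the sum of the squared
norms. -/
theorem IsNull.add (hip : IsInnerProduct ip) (hu : IsNull F ip u) (hv : IsNull F ip v) :
    IsNull F ip fun n => u n + v n := by
  have hB := IsHermitianForm.of_isInnerProduct hip
  have add_right : ∀ f g h, ip f (g + h) = ip f g + ip f h := by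
    intro f g h
    rw [hip.conj_symm, hip.add_left, map_add, ← hip.conj_symm, ← hip.conj_symm]
  have smul_right : ∀ (c : ℂ) f g, ip f (c • g) = (starRingEnd ℂ) c * ip f g := by
    intro c f g
    rw [hip.conj_symm, hip.smul_left, map_mul, ← hip.conj_symm]
  have hle : ∀ f g, (ip (f + g) (f + g)).re ≤ 2 * (ip f f).re + 2 * (ip g g).re := by
    intro f g
    have h := hip.nonneg (f + (-1 : ℂ) • g)
    simp only [hip.add_left, add_right, hip.smul_left, smul_right, map_neg, map_one] at h ⊢
    simp at h ⊢
    linarith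
  refine ⟨fun x => ?_, ?_⟩
  · have := (hu.pointwise x).add (hv.pointwise x)
    rwa [add_zero] at this
  · refine squeeze_zero (fun n => hip.nonneg _) (fun n => hle _ _) ?_
    simpa using (hu.norm.const_mul 2).add (hv.norm.const_mul 2)

theorem IsNull.const_smul (hip : IsInnerProduct ip) (c : ℂ) (hu : IsNull F ip u) :
    IsNull F ip fun n => c • u n := by
  have hs : ∀ f, ip (c • f) (c • f) = c * (starRingEnd ℂ) c * ip f f := by
    intro f
    rw [hip.smul_left, hip.conj_symm, hip.smul_left, map_mul, ← hip.conj_symm, mul_assoc]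
  refine ⟨fun x => ?_, ?_⟩
  · have := (hu.pointwise x).const_mul c
    rwa [mul_zero] at this
  · simp only [hs, Complex.mul_conj, Complex.re_ofReal_mul]
    simpa using hu.norm.const_mul (Complex.normSq c)

end IsNull

/-! ### The directed system and the strong contraction -/

section Embedding

variable {R : ℝ} (hR : 0 < R)
  {φ : ∀ i j : ℕ+, i ≤ j → (dilatedHarm i (eps R i) →ₗ[ℂ] dilatedHarm j (eps R j))}

theorem IsHarmonicEmbedding.apply_chiVec (hφ : IsHarmonicEmbedding R φ) {i j : ℕ+} (h : i ≤ j)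
    {m : ℤ} (hm : m.natAbs ≤ i) :
    φ i j h (chiVec i (eps_pos hR i) m) = chiVec j (eps_pos hR j) m :=
  Subtype.ext (hφ i j h m (mem_Icc_iff_natAbs.2 hm) _ rfl)

theorem exists_isHarmonicEmbedding {R : ℝ} (hR : 0 < R) : ∃ φ, IsHarmonicEmbedding R φ := by
  refine ⟨fun i j _ => (harmBasis i (eps_pos hR i)).constr ℂ fun m => chiVec j (eps_pos hR j) m,
    fun i j _ m hm f hf => ?_⟩
  obtain rfl : f = harmBasis i (eps_pos hR i) ⟨m, hm⟩ := by
    rw [harmBasis_apply]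
    exact Subtype.ext hf
  rw [Module.Basis.constr_basis]
  rfl

theorem limitMap_embedding (hφ : IsHarmonicEmbedding R φ) {i j : ℕ+} (h : i ≤ j)
    (f : dilatedHarm i (eps R i)) : limitMap hR j (φ i j h f) = limitMap hR i f := by
  rw [← LinearMap.comp_apply]
  congr 1
  refine (harmBasis i (eps_pos hR i)).ext fun m => ?_
  have hm := mem_Icc_iff_natAbs.1 m.2
  rw [LinearMap.comp_apply, harmBasis_apply, hφ.apply_chiVec hR h hm, limitMap_chiVec hR i hm,
    limitMap_chiVec hR j (hm.trans h)]

theorem tendsto_embedding (hφ : IsHarmonicEmbedding R φ) (j : ℕ+) (f : dilatedHarm j (eps R j))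
    {x : ℝ × ℝ} (hx : x ∈ plane) :
    Tendsto (fun n : Set.Ici j => (φ j n n.2 f : ℝ × ℝ → ℂ) x) atTop
      (𝓝 ((limitMap hR j f : ℝ × ℝ → ℂ) x)) := by
  have hf := (harmBasis j (eps_pos hR j)).mem_span f
  induction hf using Submodule.span_induction with
  | mem f h =>
    obtain ⟨m, rfl⟩ := h
    have hm := mem_Icc_iff_natAbs.1 m.2
    rw [harmBasis_apply, limitMap_chiVec hR j hm]
    refine (tendsto_comp_val_Ici_atTop.2 (tendsto_chi hR m hx)).congr fun n => ?_
    rw [hφ.apply_chiVec hR n.2 hm]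
    rfl
  | zero =>
    simp only [map_zero]
    exact tendsto_const_nhds
  | add f g _ _ hf hg =>
    simp only [map_add]
    exact hf.add hg
  | smul c f _ hf =>
    simp only [map_smul]
    exact hf.const_mul c

theorem exists_limitMap_eq (hφ : IsHarmonicEmbedding R φ) (G : besselSpace R) :
    ∃ j, ∃ f, limitMap hR j f = G := by
  have hG := (besselBasis hR).mem_span G
  induction hG using Submodule.span_induction with
  | mem G h =>
    obtain ⟨m, rfl⟩ := h
    refine ⟨m.natAbs.succPNat, chiVec _ (eps_pos hR _) (-m), ?_⟩
    rw [limitMap_chiVec hR _ (by simp), neg_neg, besselBasis_apply]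
  | zero => exact ⟨1, 0, map_zero _⟩
  | add F G _ _ hF hG =>
    obtain ⟨i, f, rfl⟩ := hF
    obtain ⟨j, g, rfl⟩ := hG
    refine ⟨max i j, φ i _ (le_max_left i j) f + φ j _ (le_max_right i j) g, ?_⟩
    rw [map_add, limitMap_embedding hR hφ, limitMap_embedding hR hφ]
  | smul c G _ hG =>
    obtain ⟨i, f, rfl⟩ := hG
    exact ⟨i, c • f, map_smul _ _ _⟩

/-- On `χ_j^m` the difference is a combination of `B_{-m+1}^R` and `B_{-m-1}^R` with coefficients
proportional to `ε_l a_{m-1} - R` and `ε_l a_m - R`. -/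
theorem isNull_contraction (hφ : IsHarmonicEmbedding R φ)
    {ρ : ∀ l : ℕ+, Rep Su2 (dilatedHarm l (eps R l))}
    (hρ : ∀ l : ℕ+, IsDilatedRep l (eps R l) (ρ l))
    {ip : besselSpace R → besselSpace R → ℂ} (hip : IsInnerProduct ip)
    {η : Rep Iso2 (besselSpace R)} (hη : IsPlaneRep R η) (j : ℕ+) (f : dilatedHarm j (eps R j))
    (Y : Su2) :
    IsNull atTop ip fun n : Set.Ici j =>
      limitMap hR n (ρ n (contractionMap (eps R n) (eps_ne_zero hR n) Y) (φ j n n.2 f)) -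
        η (psi Y) (limitMap hR j f) := by
  have hf := (harmBasis j (eps_pos hR j)).mem_span f
  induction hf using Submodule.span_induction with
  | mem f h =>
    obtain ⟨m, rfl⟩ := h
    have hm := mem_Icc_iff_natAbs.1 m.2
    have hcoeff : ∀ k : ℤ, ∀ a : ℂ, Tendsto (fun n : Set.Ici j =>
        a * (eps R n * ladder (n : ℕ+) k - R : ℂ)) atTop (𝓝 0) := by
      intro k a
      have h1 := (Complex.continuous_ofReal.tendsto _).comp (tendsto_eps_mul_ladder (R := R) k)
      have h2 := (h1.sub_const (R : ℂ)).const_mul a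
      rw [sub_self, mul_zero] at h2
      refine (tendsto_comp_val_Ici_atTop.2 h2).congr fun n => ?_
      simp
    have key : ∀ n : Set.Ici j,
        limitMap hR n (ρ n (contractionMap (eps R n) (eps_ne_zero hR n) Y)
          (φ j n n.2 (harmBasis j (eps_pos hR j) m))) -
          η (psi Y) (limitMap hR j (harmBasis j (eps_pos hR j) m)) =
        (suLower Y * (eps R n * ladder (n : ℕ+) (m - 1) - R : ℂ)) • besselVec R (-m + 1) +
        (suRaise Y * (eps R n * ladder (n : ℕ+) m - R : ℂ)) • besselVec R (-m - 1) := by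
      intro n
      have hmn : (m : ℤ).natAbs ≤ (n : ℕ+) := hm.trans n.2
      rw [harmBasis_apply, hφ.apply_chiVec hR n.2 hm, limitMap_chiVec hR j hm,
        (hρ n).apply_chiVec (eps_pos hR n), hη.apply_besselVec hR]
      have e1 : suLower (contractionMap (eps R n) (eps_ne_zero hR n) Y) = eps R n * suLower Y := by
        simp [suLower_apply, contractionMap]; ring
      have e2 : suRaise (contractionMap (eps R n) (eps_ne_zero hR n) Y) = eps R n * suRaise Y := by
        simp [suRaise_apply, contractionMap]; ring
      have e3 : suWeight (contractionMap (eps R n) (eps_ne_zero hR n) Y) = suWeight Y := by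
        simp [suWeight_apply, contractionMap]
      have e4 : isoLower (psi Y) = suRaise Y := by
        simp [isoLower_apply, suRaise_apply, psi]; ring
      have e5 : isoRaise (psi Y) = suLower Y := by
        simp [isoRaise_apply, suLower_apply, psi]; ring
      have e6 : isoWeight (psi Y) = -suWeight Y := by
        simp [isoWeight_apply, suWeight_apply, psi]
      simp only [map_add, map_smul, mul_smul, limitMap_lower hR _ hmn, limitMap_raise hR _ hmn,
        limitMap_chiVec hR _ hmn, e1, e2, e3, e4, e5, e6]
      push_cast
      module
    simp only [key]
    exact (IsNull.smul_vec hip (hcoeff _ _) _).add hip (IsNull.smul_vec hip (hcoeff _ _) _)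
  | zero =>
    have := IsNull.smul_vec (F := (atTop : Filter (Set.Ici j))) hip
      (tendsto_const_nhds (x := (0 : ℂ))) (0 : besselSpace R)
    simpa using this
  | add f g _ _ hf hg =>
    have := hf.add hip hg
    simpa only [map_add, add_sub_add_comm] using this
  | smul c f _ hf =>
    have := hf.const_smul hip c
    simpa only [map_smul, smul_sub] using this

theorem isStrongContraction_of_data (hφ : IsHarmonicEmbedding R φ)
    {ρ : ∀ l : ℕ+, Rep Su2 (dilatedHarm l (eps R l))}
    (hρ : ∀ l : ℕ+, IsDilatedRep l (eps R l) (ρ l))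
    {ip : besselSpace R → besselSpace R → ℂ} (hip : IsBesselInner R ip)
    {η : Rep Iso2 (besselSpace R)} (hη : IsPlaneRep R η) :
    IsStrongContraction (fun l : ℕ+ => contractionMap (eps R l) (eps_ne_zero hR l)) psi
      (fun l : ℕ+ => disc (eps R l)) (fun l : ℕ+ => dilatedMeasure l (eps R l))
      (fun l : ℕ+ => dilatedHarm l (eps R l)) φ ρ plane (besselSpace R) ip η where
  lie_contraction := isLieContraction_contractionMap hR
  mono _ _ h := disc_eps_mono hR h
  union := plane_eq_iUnion hR
  support_V l f hf x hx := (isRadiallyContinuous_dilatedHarm (eps_pos hR l) hf).1 x hx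
  memLp_V l f hf := memLp_dilatedHarm l (eps_pos hR l) hf
  inner_V l := by
    rw [l2Inner_eq_basisForm l (eps_pos hR l)]
    exact isInnerProduct_basisForm (by positivity) _
  support_W F hF x hx := (isRadiallyContinuous_besselSpace hF).1 x hx
  inner_W := hip.1
  isometric i j h f g := by
    have hmap : ∀ m : Set.Icc (-((i : ℕ) : ℤ)) (i : ℕ),
        (m : ℤ) ∈ Set.Icc (-((j : ℕ) : ℤ)) (j : ℕ) :=
      fun m => mem_Icc_iff_natAbs.2 ((mem_Icc_iff_natAbs.1 m.2).trans h)
    rw [l2Inner_eq_basisForm i (eps_pos hR i), l2Inner_eq_basisForm j (eps_pos hR j)]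
    refine basisForm_map (by positivity) _ _ (e := fun m => ⟨m, hmap m⟩)
      (by rintro ⟨a, ha⟩ ⟨b, hb⟩ hab; simpa using hab) _ (fun m => ?_) f g
    rw [harmBasis_apply, harmBasis_apply, hφ.apply_chiVec hR h (mem_Icc_iff_natAbs.1 m.2)]
  refl l f := by
    rw [← LinearMap.id_apply (R := ℂ) f]
    refine congrArg (· f) ((harmBasis l (eps_pos hR l)).ext (f₁ := φ l l le_rfl) (f₂ := .id)
      fun m => ?_)
    rw [harmBasis_apply, hφ.apply_chiVec hR le_rfl (mem_Icc_iff_natAbs.1 m.2)]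
    rfl
  compatible i j k h₁ h₂ f := by
    rw [← LinearMap.comp_apply]
    refine congrArg (· f) ((harmBasis i (eps_pos hR i)).ext (f₁ := φ j k h₂ ∘ₗ φ i j h₁)
      (f₂ := φ i k (h₁.trans h₂)) fun m => ?_)
    have hm := mem_Icc_iff_natAbs.1 m.2
    rw [LinearMap.comp_apply, harmBasis_apply, hφ.apply_chiVec hR h₁ hm,
      hφ.apply_chiVec hR h₂ (hm.trans h₁), hφ.apply_chiVec hR _ hm]
  limit := by
    refine ⟨fun l f => limitMap hR l f, fun j f x hx => tendsto_embedding hR hφ j f hx,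
      exists_limitMap_eq hR hφ, fun j f g => ?_, fun j f Y => ?_⟩
    · rw [hip.eq_basisForm hR, l2Inner_eq_basisForm j (eps_pos hR j)]
      refine basisForm_map (by positivity) _ _
        (e := fun m : Set.Icc (-((j : ℕ) : ℤ)) (j : ℕ) => -(m : ℤ))
        (by rintro ⟨a, ha⟩ ⟨b, hb⟩ hab; simpa using hab) _ (fun m => ?_) f g
      rw [harmBasis_apply, besselBasis_apply, limitMap_chiVec hR j (mem_Icc_iff_natAbs.1 m.2)]
    · have h := isNull_contraction hR hφ hρ hip.1 hη j f Y
      refine ⟨fun x _ => tendsto_sub_nhds_zero_iff.1 (h.pointwise x), ?_⟩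
      have := (Real.continuous_sqrt.tendsto 0).comp h.norm
      rwa [Real.sqrt_zero] at this

end Embedding

end StrongContraction


theorem proposition7 (R : ℝ) (hR : 0 < R) :
    -- the pointwise limit of the spherical harmonics
    (∀ (m : ℤ) (θ φ : ℝ), 0 ≤ θ →
      Filter.Tendsto
        (fun l : ℕ+ => StrongContraction.sphericalY l m (StrongContraction.eps R l * θ) φ)
        Filter.atTop
        (nhds (Complex.I ^ m * (StrongContraction.besselJ m (R * θ) : ℂ) *
          Complex.exp (-(Complex.I * m * φ))))) ∧
    -- the embeddings, the representations and the inner product on the limit space exist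
    (∃ φ, StrongContraction.IsHarmonicEmbedding R φ) ∧
    (∀ l : ℕ+, ∃ ρ, StrongContraction.IsDilatedRep l (StrongContraction.eps R l) ρ) ∧
    LinearIndependent ℂ (StrongContraction.besselMode R) ∧
    (∃ ip, StrongContraction.IsBesselInner R ip) ∧
    (∃ η, StrongContraction.IsPlaneRep R η) ∧
    -- the strong contraction
    (∀ (φ : ∀ i j : ℕ+, i ≤ j →
          (StrongContraction.dilatedHarm i (StrongContraction.eps R i) →ₗ[ℂ]
            StrongContraction.dilatedHarm j (StrongContraction.eps R j)))
        (ρ : ∀ l : ℕ+, StrongContraction.Rep StrongContraction.Su2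
          (StrongContraction.dilatedHarm l (StrongContraction.eps R l)))
        (ip : StrongContraction.besselSpace R → StrongContraction.besselSpace R → ℂ)
        (η : StrongContraction.Rep StrongContraction.Iso2 (StrongContraction.besselSpace R)),
      StrongContraction.IsHarmonicEmbedding R φ →
      (∀ l : ℕ+, StrongContraction.IsDilatedRep l (StrongContraction.eps R l) (ρ l)) →
      StrongContraction.IsBesselInner R ip →
      StrongContraction.IsPlaneRep R η →
      StrongContraction.IsStrongContraction
        (fun l : ℕ+ => StrongContraction.contractionMap (StrongContraction.eps R l)
          (StrongContraction.eps_ne_zero hR l))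
        StrongContraction.psi
        (fun l : ℕ+ => StrongContraction.disc (StrongContraction.eps R l))
        (fun l : ℕ+ => StrongContraction.dilatedMeasure l (StrongContraction.eps R l))
        (fun l : ℕ+ => StrongContraction.dilatedHarm l (StrongContraction.eps R l))
        φ ρ StrongContraction.plane (StrongContraction.besselSpace R) ip η) := by
  open StrongContraction in
  exact ⟨fun m θ φ _ => tendsto_sphericalY R m θ φ, exists_isHarmonicEmbedding hR,
    fun l => ⟨harmRep l (eps_pos hR l), isDilatedRep_harmRep l (eps_pos hR l)⟩,
    linearIndependent_besselMode hR, ⟨_, isBesselInner_basisForm hR⟩,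
    ⟨besselRep hR, isPlaneRep_besselRep hR⟩,
    fun _ _ _ _ hφ hρ hip hη => isStrongContraction_of_data hR hφ hρ hip hη⟩
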